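/- There are two agents with a common additive utility function $u$ on a finite set of goods $M$, with values $u(g)\ge 0$. An allocation $\mathcal A=(A_1,A_2)$ is an ordered partition of $M$. It is EF1 if for all $i\ne j$ either $A_j=\emptyset$ or $u(A_i)\ge u(A_j\setminus\{g\})$ for some $g\in A_j$. An exchange swaps one good of $A_1$ with one good of $A_2$. The optimal number of exchanges from $\mathcal A$ is the smallest number $T$ of successive exchanges that lead from $\mathcal A$ to some EF1 allocation, and $\infty$ if no EF1 allocation can be reached. A greedy exchange, made when one agent's bundle has strictly higher utility than the other's, swaps a most valuable good of the richer agent with a least valuable good of the other agent, ties between goods being broken arbitrarily. (a) The following decision problem is in P. Input: a nonempty list of goods, each with an initial owner (one of the two agents) and a rational utility given as a fraction $a/b$ with integers $a\ge 0$, $b\ge 1$ written in binary, and an integer $k\ge 0$ written in binary. Question: is the optimal number of exchanges from the initial allocation at most $k$? That is, the language of the encodings of all yes-instances is decided by a deterministic Turing machine in time polynomial in the length of the input word. (b) The greedy algorithm is optimal. Let $u$ be real-valued, let $\mathcal A$ be an allocation whose optimal number of exchanges $T^*$ is finite, and perform greedy exchanges starting from $\mathcal A$ as long as the current allocation is not EF1.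 Then at most $T^*$ exchanges are ever made; whenever the current allocation is not EF1, a greedy exchange is possible; and when an EF1 allocation is reached, exactly $T^*$ exchanges have been made. -/

import Mathlib

open scoped NNReal

noncomputable section

namespace FairDivision

/-! ### Allocations, EF1, exchanges -/

/-- An allocation of the goods `M` to the agents `N` (an ordered partition of `M` indexed by `N`),
given by the map sending each good to the agent who owns it. -/
abbrev Allocation (N M : Type*) := M → N

section Basic

variable {N M : Type*} [DecidableEq N] [Fintype M] [DecidableEq M]

/-- The bundle `A_i` of agent `i` in the allocation `A`. -/
def bundle (A : Allocation N M) (i : N) : Finset M := Finset.univ.filter fun g => A g = i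

/-- The additive extension to bundles of the utilities of single goods. -/
def util (u : M → ℝ≥0) (S : Finset M) : ℝ≥0 := ∑ g ∈ S, u g

/-- Agent `i` is EF1 towards agent `j` in `A`. -/
def EF1Towards (u : N → M → ℝ≥0) (A : Allocation N M) (i j : N) : Prop :=
  bundle A j = ∅ ∨ ∃ g ∈ bundle A j, util (u i) (bundle A i) ≥ util (u i) (bundle A j \ {g})

/-- The allocation `A` is EF1. -/
def EF1 (u : N → M → ℝ≥0) (A : Allocation N M) : Prop :=
  ∀ i j, i ≠ j → EF1Towards u A i j

/-- `B` arises from `A` when `i` gives `g` to `j` and simultaneously receives `g'` from `j`. -/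
def ExchangeOf (A B : Allocation N M) (i j : N) (g g' : M) : Prop :=
  i ≠ j ∧ g ∈ bundle A i ∧ g' ∈ bundle A j ∧
    bundle B i = (bundle A i ∪ {g'}) \ {g} ∧ bundle B j = (bundle A j ∪ {g}) \ {g'} ∧
    ∀ l, l ≠ i → l ≠ j → bundle B l = bundle A l

/-- `A` and `B` can be reached via an exchange. -/
def Exchange (A B : Allocation N M) : Prop := ∃ i j g g', ExchangeOf A B i j g g'

/-- `B` can be reached from `A` by a sequence of exactly `T` exchanges. -/
def ReachedIn (T : ℕ) (A B : Allocation N M) : Prop :=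
  ∃ s : ℕ → Allocation N M, s 0 = A ∧ s T = B ∧ ∀ t < T, Exchange (s t) (s (t + 1))

/-- The optimal number of exchanges required to reach `B` from `A` (`⊤` if unreachable). -/
def exchangeDist (A B : Allocation N M) : ℕ∞ := ⨅ (T : ℕ) (_ : ReachedIn T A B), (T : ℕ∞)

/-- The optimal number of exchanges required to reach some EF1 allocation from `A`
(`⊤` if no EF1 allocation can be reached). -/
def optimalExchanges (u : N → M → ℝ≥0) (A : Allocation N M) : ℕ∞ :=
  ⨅ (B : Allocation N M) (_ : EF1 u B), exchangeDist A B

/-- A greedy exchange for a common utility function `u`: an agent `j` with the higher utility gives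
a most valuable good `g'` of her bundle to an agent `i` with the lower utility and receives
a least valuable good `g` of the bundle of `i`. Ties between goods are broken arbitrarily. -/
def GreedyExchange (u : M → ℝ≥0) (A B : Allocation N M) : Prop :=
  ∃ i j g g', ExchangeOf A B i j g g' ∧ util u (bundle A i) < util u (bundle A j) ∧
    (∀ h ∈ bundle A i, u g ≤ u h) ∧ ∀ h ∈ bundle A j, u h ≤ u g'

/-- `B` is the current allocation after `T` steps of a run of the greedy algorithm started at `A`:
the algorithm performs greedy exchanges and stops as soon as an EF1 allocation is reached. -/
def GreedyRun (u : M → ℝ≥0) (T : ℕ) (A B : Allocation N M) : Prop :=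
  ∃ s : ℕ → Allocation N M, s 0 = A ∧ s T = B ∧
    ∀ t < T, ¬ EF1 (fun _ => u) (s t) ∧ GreedyExchange u (s t) (s (t + 1))

end Basic

/-! ### The decision problem for two agents with identical utilities -/

/-- The data of one good in an input: its initial owner and its utility `num / den`. -/
structure GoodData where
  owner : Bool
  num : ℕ
  den : ℕ+

/-- An input of the problem: a nonempty list of goods, with their common rational utilities and
their initial owners (there are two agents, `false` and `true`), and a number `k`. -/
structure Input where
  goods : List GoodData
  nonempty : goods ≠ []
  k : ℕ

namespace Input

/-- The set of goods of the instance. -/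
abbrev Goods (I : Input) : Type := Fin I.goods.length

/-- The common utility function. -/
def utility (I : Input) (g : I.Goods) : ℝ≥0 := (I.goods.get g).num / ((I.goods.get g).den : ℕ)

/-- The initial allocation. -/
def initial (I : Input) : Allocation Bool I.Goods := fun g => (I.goods.get g).owner

/-- The answer is yes: the optimal number of exchanges to reach an EF1 allocation is at most `k`. -/
def IsYes (I : Input) : Prop :=
  optimalExchanges (fun _ : Bool => I.utility) I.initial ≤ (I.k : ℕ∞)

end Input

/-! ### Encoding of inputs as words -/

open Computability (Γ')

/-- The binary expansion of `n` (least significant bit first, no superfluous zeros). -/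
def encNat (n : ℕ) : List Γ' := n.bits.map Γ'.bit

/-- A good is written as `[`, its owner, its numerator, a comma, its denominator, `]`. -/
def encGood (g : GoodData) : List Γ' :=
  Γ'.bra :: Γ'.bit g.owner :: (encNat g.num ++ Γ'.comma :: (encNat (g.den : ℕ) ++ [Γ'.ket]))

/-- An input is written as `k` in binary, followed by the goods one after the other. -/
def encInput (I : Input) : List Γ' := encNat I.k ++ I.goods.flatMap encGood

/-- `Optimal Exchanges` for two agents with identical utilities, as a language: the set of
encodings of the yes-instances. -/
def OptimalExchangesTwoIdentical : Language Γ' := {w | ∃ I : Input, encInput I = w ∧ I.IsYes}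

theorem encNat_append_inj {a b : ℕ} {x y : Γ'} {r s : List Γ'} (hx : ∀ c, x ≠ Γ'.bit c)
    (hy : ∀ c, y ≠ Γ'.bit c) (h : encNat a ++ x :: r = encNat b ++ y :: s) :
    a = b ∧ x = y ∧ r = s := by
  have key : ∀ l l' : List Bool, l.map Γ'.bit ++ x :: r = l'.map Γ'.bit ++ y :: s →
      l = l' ∧ x = y ∧ r = s := by
    intro l
    induction l with
    | nil => rintro (_ | ⟨c, l'⟩) h <;> simp_all
    | cons c l ih =>
      rintro (_ | ⟨c', l'⟩) h
      · simp only [List.map_cons, List.cons_append, List.map_nil, List.nil_append,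
          List.cons.injEq] at h
        exact absurd h.1.symm (hy c)
      · simp only [List.map_cons, List.cons_append, List.cons.injEq, Γ'.bit.injEq] at h
        obtain ⟨h1, h2⟩ := ih l' h.2
        exact ⟨by rw [h.1, h1], h2⟩
  obtain ⟨h1, h2⟩ := key _ _ h
  refine ⟨?_, h2⟩
  have h3 := congrArg (fun l : List Bool => l.foldr Nat.bit 0) h1
  have hb : ∀ n : ℕ, n.bits.foldr Nat.bit 0 = n := by
    intro n
    induction n using Nat.binaryRec' with
    | zero => simp
    | bit c n hn ih => rw [Nat.bits_append_bit _ _ hn, List.foldr_cons, ih]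
  simpa only [hb] using h3

theorem encGood_append_inj {g g' : GoodData} {r s : List Γ'}
    (h : encGood g ++ r = encGood g' ++ s) : g = g' ∧ r = s := by
  obtain ⟨o, n, d⟩ := g
  obtain ⟨o', n', d'⟩ := g'
  simp only [encGood, List.cons_append, List.append_assoc, List.cons.injEq, Γ'.bit.injEq,
    true_and, List.nil_append] at h
  obtain ⟨rfl, h⟩ := h
  obtain ⟨rfl, -, h⟩ := encNat_append_inj (by simp) (by simp) h
  obtain ⟨hd, -, h⟩ := encNat_append_inj (by simp) (by simp) h
  rw [PNat.coe_inj] at hd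
  exact ⟨by rw [hd], h⟩

/-- Distinct inputs have distinct encodings. -/
theorem encInput_injective : Function.Injective encInput := by
  have key : ∀ l l' : List GoodData, l.flatMap encGood = l'.flatMap encGood → l = l' := by
    intro l
    induction l with
    | nil => rintro (_ | ⟨g, l'⟩) h <;> simp_all [encGood]
    | cons g l ih =>
      rintro (_ | ⟨g', l'⟩) h
      · simp [encGood] at h
      · obtain ⟨h1, h2⟩ := encGood_append_inj (by simpa only [List.flatMap_cons] using h)
        rw [h1, ih _ h2]
  rintro ⟨_ | ⟨g, l⟩, hl, k⟩ ⟨_ | ⟨g', l'⟩, hl', k'⟩ h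
  · exact absurd rfl hl
  · exact absurd rfl hl
  · exact absurd rfl hl'
  · simp only [encInput, List.flatMap_cons, encGood, List.cons_append] at h
    obtain ⟨rfl, -, h⟩ := encNat_append_inj (by simp) (by simp) h
    have := key (g :: l) (g' :: l')
      (by simpa only [List.flatMap_cons, encGood, List.cons_append, List.cons.injEq, true_and]
        using h)
    simp only [this]

/-! ### The class P -/

open Classical in
/-- A language over a finite alphabet is in P if a (deterministic, multi-stack) Turing machine with
finite alphabets, given an arbitrary word, outputs whether the word lies in the language, within
a number of steps that is polynomial in the length of the word. -/
def InP {Γ : Type} [Fintype Γ] (L : Language Γ) : Prop :=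
  ∃ c : Turing.TM2ComputableInPolyTime (id : List Γ → List Γ) Computability.encodeBool
    (fun w => decide (w ∈ L)), ∀ k, Finite (c.tm.Γ k)

end FairDivision

end

noncomputable section

namespace FairDivision

/-! ### A language of polynomial-time functions on binary trees -/

/-! Optimality is an exchange argument. Exchanges keep the sizes of both bundles, and each one takes
at most one good from a given agent, so `moved j A C` is a lower bound for the number of exchanges
leading from `A` to `C`. Suppose that `i` is not EF1 towards `j` in `A`, and let `C` have the same
bundle sizes with `i` EF1 towards `j`. The goods of `C` can be relabelled so that the goods `g'` and
`g` of a greedy exchange are among those that change hands; this does not raise the value of the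
bundle of `j` up to one good, nor lower that of `i`. The new target is still fair from `i` to `j`,
and it is one exchange closer to the allocation after the greedy step (`GreedyStep.exists_closer`).

The argument iterates because envy never changes direction: right after a greedy exchange that
relieves `i`, agent `j` is EF1 towards `i` (`GreedyStep.ef1Towards`). Hence a run of length `T` has
`T ≤ moved j A C` for a suitable agent `j` and any reachable EF1 target `C`. So a run is never
longer than the optimum, and a run that ends in an EF1 allocation attains it.

The same inequality bounds a run by the number of goods when the optimum is finite. Simulating that
many rounds therefore decides the problem: if no EF1 allocation has appeared by then, none is
reachable. Fractions need not be reduced, since under multiplication of denominators the bit lengths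
only add up.

For membership in P, Turing machines are handled once and for all. Programs on binary trees, built
from pairing, composition and folds over lists, carry an explicit cost, and an interpreter with a
control stack runs each of them within that cost (`Machine.reach_code`). `PolyTime` is then closed
under composition and under folds whose intermediate values stay polynomially small
(`PolyTime.foldl`). This closure gives binary arithmetic, the greedy algorithm and the parser. The
parser is verified through its inverse `unparse`, so that it accepts exactly the encodings. -/

/-- Binary trees, the values of the language. -/
inductive Val
  | nil
  | cons (a b : Val)

namespace Val

/-- The prefix serialization of a tree. -/
def ser : Val → List Bool
  | nil => [false]
  | cons a b => true :: (ser a ++ ser b)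

/-- The length of the serialization. -/
def size : Val → ℕ
  | nil => 1
  | cons a b => size a + size b + 1

@[simp] theorem length_ser (v : Val) : v.ser.length = v.size := by
  induction v with
  | nil => rfl
  | cons a b iha ihb => simp [ser, size, iha, ihb]

theorem one_le_size (v : Val) : 1 ≤ v.size := by cases v <;> simp [size]

/-- Left fold over the right spine of a tree. -/
def fold (F : Val → Val → Val) : Val → Val → Val
  | nil, s => s
  | cons h t, s => fold F t (F h s)

/-- The cost of a left fold. -/
def foldCost (F : Val → Val → Val) (C : Val → Val → ℕ) : Val → Val → ℕ
  | nil, _ => 2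
  | cons h t, s => 20 * h.size + 20 + C h s + foldCost F C t (F h s)

end Val

/-- Programs computing functions on trees. -/
inductive Code
  | id
  | nil
  | fst
  | snd
  | pair (f g : Code)
  | comp (f g : Code)
  | fold (f : Code)

namespace Code

/-- The function computed by a program. -/
def eval : Code → Val → Val
  | id, v => v
  | nil, _ => .nil
  | fst, .cons a _ => a
  | fst, .nil => .nil
  | snd, .cons _ b => b
  | snd, .nil => .nil
  | pair f g, v => .cons (eval f v) (eval g v)
  | comp f g, v => eval f (eval g v)
  | fold _, .nil => .nil
  | fold f, .cons l s => Val.fold (fun h s => eval f (.cons h s)) l s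

/-- An upper bound for the running time of a program. -/
def cost : Code → Val → ℕ
  | id, _ => 2
  | nil, v => 20 * v.size + 20
  | fst, v => 20 * v.size + 20
  | snd, v => 20 * v.size + 20
  | pair f g, v => cost g v + cost f v + 20 * (v.size + (eval g v).size) + 20
  | comp f g, v => cost g v + cost f (eval g v) + 2
  | fold _, .nil => 4
  | fold f, .cons l s => 20 * l.size + 20 +
      Val.foldCost (fun h s => eval f (.cons h s)) (fun h s => cost f (.cons h s)) l s

/-- The subprograms of a program. -/
def subs : Code → List Code
  | pair f g => pair f g :: (subs f ++ subs g)
  | comp f g => comp f g :: (subs f ++ subs g)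
  | fold f => fold f :: subs f
  | id => [id]
  | nil => [nil]
  | fst => [fst]
  | snd => [snd]

theorem mem_subs_self (c : Code) : c ∈ c.subs := by cases c <;> simp [subs]

theorem subs_trans {c d e : Code} (h₁ : c ∈ d.subs) (h₂ : d ∈ e.subs) : c ∈ e.subs := by
  induction e with
  | pair f g ihf ihg | comp f g ihf ihg =>
    simp only [subs, List.mem_cons, List.mem_append] at h₂ ⊢
    rcases h₂ with rfl | h | h
    · simpa [subs] using h₁
    · exact .inr (.inl (ihf h))
    · exact .inr (.inr (ihg h))
  | fold f ih =>
    simp only [subs, List.mem_cons] at h₂ ⊢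
    rcases h₂ with rfl | h
    · simpa [subs] using h₁
    · exact .inr (ih h)
  | _ =>
    simp only [subs, List.mem_singleton] at h₂
    subst h₂
    exact h₁

/-- The type of subprograms of a program. -/
abbrev Sub (c : Code) : Type := {d : Code // d ∈ c.subs}

open Classical in
/-- View a program as a subprogram of `c`, with a default value. -/
def lift (c d : Code) : c.Sub := if h : d ∈ c.subs then ⟨d, h⟩ else ⟨c, c.mem_subs_self⟩

theorem lift_val {c d : Code} (h : d ∈ c.subs) : (c.lift d).1 = d := by simp [lift, h]

end Code

/-! ### A Turing machine interpreting programs -/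

open Computability (Γ')
open Turing.TM2 (Stmt stepAux)

/-- The stacks that hold serialized trees. -/
inductive DataStk
  | main | aux | t₁ | t₂
  deriving DecidableEq

instance : Fintype DataStk := ⟨{.main, .aux, .t₁, .t₂}, by intro x; cases x <;> simp⟩

/-- The stacks of the interpreter. -/
inductive Stk
  | ctl | inp | out
  | data (d : DataStk)
  deriving DecidableEq, Fintype

/-- The tasks on the control stack of the interpreter. -/
inductive Task (Θ : Type)
  | start
  | code (c : Θ)
  | loop (c : Θ)
  | tok (b : Bool)
  | drop
  | move (x y : DataStk)
  | pour (x y : DataStk)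
  | pour₂
  | input
  | sym (s : Γ')
  | output
  deriving Fintype

namespace Task

/-- Rename the programs in a task. -/
def map {Θ Θ' : Type} (f : Θ → Θ') : Task Θ → Task Θ'
  | start => start
  | code c => code (f c)
  | loop c => loop (f c)
  | tok b => tok b
  | drop => drop
  | move x y => move x y
  | pour x y => pour x y
  | pour₂ => pour₂
  | input => input
  | sym s => sym s
  | output => output

end Task

/-- The unary encoding of the position of a symbol in the alphabet. -/
def symIdx : Γ' → ℕ
  | .blank => 0
  | .bit false => 1
  | .bit true => 2
  | .bra => 3
  | .ket => 4
  | .comma => 5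

/-- Binary digits as a tree. -/
def bitsVal : List Bool → Val
  | [] => .nil
  | false :: l => .cons .nil (bitsVal l)
  | true :: l => .cons (.cons .nil .nil) (bitsVal l)

/-- The tree that represents a symbol. -/
def symVal (s : Γ') : Val := bitsVal (symIdx s).bits

/-- The tree that represents a word. -/
def wordVal : List Γ' → Val
  | [] => .nil
  | s :: l => .cons (symVal s) (wordVal l)

namespace Machine

variable (c : Code)

/-- The stack alphabets. -/
abbrev Alph : Stk → Type
  | .ctl => Task c.Sub
  | .inp => Γ'
  | .out => Bool
  | .data _ => Bool

/-- The labels: `none` fetches the next task, `some t` executes `t`. -/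
abbrev Lab : Type := Option (Task c.Sub)

/-- The internal states: the last symbols popped. -/
abbrev St : Type := Option (Task c.Sub) × Option Bool × Option Γ'

/-- The statements of the interpreter. -/
abbrev St' : Type := Stmt (Alph c) (Lab c) (St c)

/-- Fetch the next task. -/
abbrev next : St' c := .goto fun _ => none

/-- Push tasks onto the control stack. -/
def pushTasks : List (Task Code) → St' c → St' c
  | [], q => q
  | t :: ts, q => pushTasks ts (.push .ctl (fun _ => t.map c.lift) q)

/-- Push a word onto the main stack. -/
def pushToks : List Bool → St' c → St' c
  | [], q => q
  | b :: l, q => pushToks l (.push (.data .main) (fun _ => b) q)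

/-- Pop a token. -/
def popTok (x : DataStk) (q : St' c) : St' c :=
  .pop (.data x) (fun v b => (v.1, b, v.2.2)) q

/-- Branch on the last token popped. -/
def ifTok (q q' : St' c) : St' c := .branch (fun v => v.2.1 == some true) q q'

/-- The tasks that duplicate the top tree of the main stack. -/
def dupTasks : List (Task Code) :=
  [.move .main .t₁, .pour₂, .pour .t₂ .t₁, .pour .t₁ .main]

/-- The tasks that swap the two top trees of the main stack. -/
def swapTasks : List (Task Code) :=
  [.move .main .t₁, .move .main .t₂, .pour .t₁ .main, .pour .t₂ .main]

/-- The execution of a program. -/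
def codeBody : Code → St' c
  | .id => next c
  | .nil => pushTasks c [.drop, .tok false] (next c)
  | .fst => popTok c .main (ifTok c
      (pushTasks c [.move .main .t₁, .drop, .pour .t₁ .main] (next c))
      (pushTasks c [.tok false] (next c)))
  | .snd => popTok c .main (ifTok c
      (pushTasks c [.drop] (next c))
      (pushTasks c [.tok false] (next c)))
  | .pair f g => pushTasks c
      (dupTasks ++ .code g :: (swapTasks ++ [.code f, .tok true])) (next c)
  | .comp f g => pushTasks c [.code g, .code f] (next c)
  | .fold f => popTok c .main (ifTok c
      (pushTasks c [.move .main .t₁, .pour .t₁ .aux, .loop f] (next c))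
      (pushTasks c [.tok false] (next c)))

/-- The execution of a task. -/
def body : Task Code → St' c
  | .start => pushTasks c [.tok false, .input, .code c, .output] (next c)
  | .code d => codeBody c d
  | .loop f => popTok c .aux (ifTok c
      (pushTasks c [.move .aux .t₁, .pour .t₁ .main, .tok true, .code f, .loop f] (next c)) (next c))
  | .tok b => .push (.data .main) (fun _ => b) (next c)
  | .drop => popTok c .main (ifTok c (pushTasks c [.drop, .drop] (next c)) (next c))
  | .move x y => popTok c x (.push (.data y) (fun v => v.2.1 == some true)
      (ifTok c (pushTasks c [.move x y, .move x y] (next c)) (next c)))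
  | .pour x y => popTok c x (.branch (fun v => v.2.1.isSome)
      (.push (.data y) (fun v => v.2.1 == some true) (pushTasks c [.pour x y] (next c))) (next c))
  | .pour₂ => popTok c .t₁ (.branch (fun v => v.2.1.isSome)
      (.push (.data .main) (fun v => v.2.1 == some true)
        (.push (.data .t₂) (fun v => v.2.1 == some true) (pushTasks c [.pour₂] (next c))))
      (next c))
  | .input => .pop .inp (fun v s => (v.1, v.2.1, s)) (.branch (fun v => v.2.2.isSome)
      (pushTasks c [.input] (.push .ctl (fun v => .sym (v.2.2.getD .blank)) (next c))) (next c))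
  | .sym s => pushToks c (true :: (symVal s).ser) (next c)
  | .output => popTok c .main (ifTok c
      (.push .out (fun _ => true) (pushTasks c [.drop, .drop] (next c)))
      (.push .out (fun _ => false) (next c)))

/-- The program of the interpreter. -/
def prog : Lab c → St' c
  | none => .pop .ctl (fun v t => (t, v.2)) (.branch (fun v => v.1.isSome)
      (.goto fun v => v.1) (.load (fun _ => (none, none, none)) .halt))
  | some t => body c (t.map Subtype.val)

/-- The contents of the stacks. -/
def mk (ks : List (Task Code)) (D : DataStk → List Bool) (i : List Γ') (o : List Bool) :
    ∀ k, List (Alph c k)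
  | .ctl => ks.map (Task.map c.lift)
  | .inp => i
  | .out => o
  | .data d => D d

/-- The contents of the data stacks. -/
def dat (m a x y : List Bool) : DataStk → List Bool
  | .main => m
  | .aux => a
  | .t₁ => x
  | .t₂ => y

/-- In at most `n` steps the interpreter gets from the stacks `S` to the stacks `S'`. -/
def Reach (n : ℕ) (S S' : ∀ k, List (Alph c k)) : Prop :=
  ∀ v : St c, ∃ k ≤ n, ∃ v' : St c,
    (flip bind (Turing.TM2.step (prog c)))^[k] (some ⟨some none, v, S⟩) = some ⟨some none, v', S'⟩

variable {c}

/-- Bounds compose because `Reach` allows an arbitrary internal state at the start: the symbols that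
the first stretch leaves in the registers do not affect the second. -/
theorem Reach.trans {n m : ℕ} {S S' S'' : ∀ k, List (Alph c k)} (h : Reach c n S S')
    (h' : Reach c m S' S'') : Reach c (n + m) S S'' := by
  intro v
  obtain ⟨k, hk, v', e⟩ := h v
  obtain ⟨k', hk', v'', e'⟩ := h' v'
  exact ⟨k' + k, by omega, v'', by rw [Function.iterate_add_apply, e, e']⟩

theorem Reach.mono {n m : ℕ} {S S' : ∀ k, List (Alph c k)} (h : Reach c n S S') (hnm : n ≤ m) :
    Reach c m S S' := by
  intro v
  obtain ⟨k, hk, r⟩ := h v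
  exact ⟨k, hk.trans hnm, r⟩

theorem pushTasks_step (ts : List (Task Code)) (q : St' c) (v : St c) (ks D i o) :
    stepAux (pushTasks c ts q) v (mk c ks D i o) = stepAux q v (mk c (ts ++ ks) D i o) := by
  induction ts generalizing q with
  | nil => rfl
  | cons t ts ih =>
    rw [pushTasks, ih, stepAux]
    congr 1
    funext k
    rcases k with _ | _ | _ | d <;> simp [mk]

/-- The task mentions only subprograms of `c`. -/
def Ok (c : Code) : Task Code → Prop
  | .code d => d ∈ c.subs
  | .loop d => d ∈ c.subs
  | _ => True

/-- The control stack stores programs in the finite type `c.Sub`. For tasks that mention only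
subprograms of `c`, the default value in `lift` is never used and the task is read back intact. -/
theorem Ok.map {t : Task Code} (h : Ok c t) : (t.map c.lift).map Subtype.val = t := by
  cases t <;> simp_all [Task.map, Ok, Code.lift_val]

/-- One machine step executes a statement up to its next jump. So a task costs two steps: one to
fetch it and one to run its body. -/
theorem reach_of_body {t : Task Code} (ht : Ok c t) {ks D i o} {S : ∀ k, List (Alph c k)}
    (h : ∀ v, ∃ v', stepAux (body c t) v (mk c ks D i o) = ⟨some none, v', S⟩) :
    Reach c 2 (mk c (t :: ks) D i o) S := by
  intro v
  obtain ⟨v', e⟩ := h (some (t.map c.lift), v.2)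
  refine ⟨2, le_rfl, v', ?_⟩
  have h1 : Turing.TM2.step (prog c) ⟨some none, v, mk c (t :: ks) D i o⟩
      = some ⟨some (some (t.map c.lift)), (some (t.map c.lift), v.2), mk c ks D i o⟩ := by
    have : Function.update (mk c (t :: ks) D i o) Stk.ctl ((mk c (t :: ks) D i o) Stk.ctl).tail
        = mk c ks D i o := by
      funext k
      rcases k with _ | _ | _ | d <;> simp [mk]
    simp only [Turing.TM2.step, prog, stepAux, this]
    simp [mk]
  have h2 : Turing.TM2.step (prog c)
      ⟨some (some (t.map c.lift)), (some (t.map c.lift), v.2), mk c ks D i o⟩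
      = some ⟨some none, v', S⟩ := by
    rw [Turing.TM2.step, prog, ht.map, e]
  change (flip bind _) ((flip bind _) _) = _
  simp only [flip, Option.bind_eq_bind, Option.bind_some, h1, h2]

theorem mk_update (ks : List (Task Code)) (D : DataStk → List Bool) (i o) (x : DataStk)
    (l : List Bool) :
    Function.update (mk c ks D i o) (.data x) l = mk c ks (Function.update D x l) i o := by
  funext k
  rcases k with _ | _ | _ | d
  · simp [mk]
  · simp [mk]
  · simp [mk]
  · by_cases h : d = x
    · subst h; simp [mk]
    · simp [mk, h]

theorem popTok_step (x : DataStk) (q : St' c) (v : St c) (ks D i o) :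
    stepAux (popTok c x q) v (mk c ks D i o) =
      stepAux q (v.1, (D x).head?, v.2.2) (mk c ks (Function.update D x (D x).tail) i o) := by
  rw [popTok, stepAux, mk_update]
  rfl

theorem ifTok_step (q q' : St' c) (v : St c) (S) :
    stepAux (ifTok c q q') v S = if v.2.1 = some true then stepAux q v S else stepAux q' v S := by
  rw [ifTok, stepAux]
  rcases h : v.2.1 with _ | _ | _ <;> simp

theorem pushTok_step (x : DataStk) (f) (q : St' c) (v : St c) (ks D i o) :
    stepAux (.push (.data x) f q) v (mk c ks D i o) =
      stepAux q v (mk c ks (Function.update D x (f v :: D x)) i o) := by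
  rw [stepAux, mk_update]
  rfl

theorem pushToks_step (l : List Bool) (q : St' c) (v : St c) (ks m a x y i o) :
    stepAux (pushToks c l q) v (mk c ks (dat m a x y) i o) =
      stepAux q v (mk c ks (dat (l ++ m) a x y) i o) := by
  induction l generalizing q with
  | nil => rfl
  | cons t ts ih =>
    rw [pushToks, ih, pushTok_step]
    congr 2
    funext k
    cases k <;> simp [dat]

end Machine
end FairDivision
end

/-! ### Running times of the interpreter's tasks -/

noncomputable section
namespace FairDivision
open Computability (Γ')
open Turing.TM2 (Stmt stepAux)
namespace Machine
variable {c : Code}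

theorem reach_tok (b : Bool) (ks m a x y i o) :
    Reach c 2 (mk c (.tok b :: ks) (dat m a x y) i o) (mk c ks (dat (b :: m) a x y) i o) := by
  refine reach_of_body (by exact trivial) fun v => ⟨v, ?_⟩
  rw [body, pushTok_step, stepAux]
  congr 2
  funext k
  cases k <;> simp [dat]

/-- A prefix serialization delimits itself: the token `true` announces two subtrees, so the task
replaces itself by two copies. One task is executed per token, at two steps each. -/
theorem reach_drop (v : Val) (ks m a x y i o) :
    Reach c (2 * v.size) (mk c (.drop :: ks) (dat (v.ser ++ m) a x y) i o)
      (mk c ks (dat m a x y) i o) := by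
  have upd (b : Bool) (l : List Bool) :
      Function.update (dat (b :: l) a x y) .main (dat (b :: l) a x y .main).tail
        = dat l a x y := by
    funext k
    cases k <;> simp [dat]
  induction v generalizing ks m with
  | nil =>
    refine reach_of_body (by exact trivial) fun v => ⟨(v.1, some false, v.2.2), ?_⟩
    rw [body, popTok_step, ifTok_step]
    simp [Val.ser, dat]
    congr 1
    funext k
    cases k <;> simp [dat]
  | cons p q ihp ihq =>
    have h : Reach c 2 (mk c (.drop :: ks) (dat ((Val.cons p q).ser ++ m) a x y) i o)
        (mk c (.drop :: .drop :: ks) (dat (p.ser ++ (q.ser ++ m)) a x y) i o) := by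
      refine reach_of_body (by exact trivial) fun v => ⟨(v.1, some true, v.2.2), ?_⟩
      rw [body, popTok_step, ifTok_step, Val.ser, List.cons_append, upd, List.append_assoc,
        if_pos (by simp [dat]), pushTasks_step]
      rfl
    exact ((h.trans (ihp _ _)).trans (ihq _ _)).mono (by simp only [Val.size]; omega)

/-- The recursion is that of `reach_drop`, but every token popped is kept on `y`, where the tree
therefore arrives reversed. -/
theorem reach_move_aux {x y : DataStk} (hxy : x ≠ y) (v : Val) (ks D r i o)
    (hD : D x = v.ser ++ r) :
    Reach c (2 * v.size) (mk c (.move x y :: ks) D i o)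
      (mk c ks (Function.update (Function.update D x r) y (v.ser.reverse ++ D y)) i o) := by
  induction v generalizing ks D r with
  | nil =>
    refine reach_of_body (by exact trivial) fun v => ⟨(v.1, some false, v.2.2), ?_⟩
    rw [body, popTok_step, pushTok_step, ifTok_step, hD]
    simp [Val.ser, hxy.symm]
  | cons p q ihp ihq =>
    have h : Reach c 2 (mk c (.move x y :: ks) D i o)
        (mk c (.move x y :: .move x y :: ks)
          (Function.update (Function.update D x (p.ser ++ (q.ser ++ r))) y (true :: D y)) i o) := by
      refine reach_of_body (by exact trivial) fun v => ⟨(v.1, some true, v.2.2), ?_⟩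
      rw [body, popTok_step, pushTok_step, ifTok_step, hD]
      simp [Val.ser, hxy.symm, pushTasks_step]
    have h' := h.trans (ihp _ _ (q.ser ++ r) (by simp [hxy]))
    have h'' := h'.trans (ihq _ _ r (by simp [hxy]))
    have h₃ : Reach c (2 * (Val.cons p q).size) _ _ := h''.mono (by simp only [Val.size]; omega)
    convert h₃ using 2
    funext k
    by_cases h1 : k = y
    · subst h1; simp [Val.ser]
    · by_cases h2 : k = x
      · subst h2; simp [hxy]
      · simp [h1, h2]

/-- Pouring empties the whole stack and reverses it, which undoes the reversal caused by a move. The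
two extra steps are the final round, which finds the stack empty. -/
theorem reach_pour_aux {x y : DataStk} (hxy : x ≠ y) (l : List Bool) (ks D i o)
    (hD : D x = l) :
    Reach c (2 * l.length + 2) (mk c (.pour x y :: ks) D i o)
      (mk c ks (Function.update (Function.update D x []) y (l.reverse ++ D y)) i o) := by
  induction l generalizing D with
  | nil =>
    refine reach_of_body (by exact trivial) fun v => ⟨(v.1, none, v.2.2), ?_⟩
    rw [body, popTok_step, hD]
    simp only [List.head?_nil, stepAux, Option.isSome_none, cond_false, List.tail_nil,
      List.reverse_nil, List.nil_append]
    congr 2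
    funext k
    by_cases h1 : k = y
    · subst h1; simp [hxy.symm]
    · simp [h1]
  | cons b l ih =>
    have h : Reach c 2 (mk c (.pour x y :: ks) D i o)
        (mk c (.pour x y :: ks)
          (Function.update (Function.update D x l) y (b :: D y)) i o) := by
      refine reach_of_body (by exact trivial) fun v => ⟨(v.1, some b, v.2.2), ?_⟩
      rw [body, popTok_step, stepAux, pushTok_step, pushTasks_step, hD]
      cases b <;> simp [hxy.symm]
    have h' := h.trans (ih _ (by simp [hxy]))
    have h₃ : Reach c (2 * (b :: l).length + 2) _ _ :=
      h'.mono (by simp only [List.length_cons]; omega)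
    convert h₃ using 2
    funext k
    by_cases h1 : k = y
    · subst h1; simp
    · by_cases h2 : k = x
      · subst h2; simp [hxy]
      · simp [h1, h2]

theorem reach_pour₂ (l : List Bool) (ks m a y i o) :
    Reach c (2 * l.length + 2) (mk c (.pour₂ :: ks) (dat m a l y) i o)
      (mk c ks (dat (l.reverse ++ m) a [] (l.reverse ++ y)) i o) := by
  induction l generalizing m y with
  | nil =>
    refine reach_of_body (by exact trivial) fun v => ⟨(v.1, none, v.2.2), ?_⟩
    rw [body, popTok_step]
    simp only [stepAux, dat, List.head?_nil, Option.isSome_none, cond_false, List.tail_nil,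
      List.reverse_nil, List.nil_append]
    congr 2
    funext k
    cases k <;> simp [dat]
  | cons b l ih =>
    have h : Reach c 2 (mk c (.pour₂ :: ks) (dat m a (b :: l) y) i o)
        (mk c (.pour₂ :: ks) (dat (b :: m) a l (b :: y)) i o) := by
      refine reach_of_body (by exact trivial) fun v => ⟨(v.1, some b, v.2.2), ?_⟩
      rw [body, popTok_step, stepAux, pushTok_step, pushTok_step, pushTasks_step]
      simp only [dat, List.head?_cons, Option.isSome_some, cond_true, List.tail_cons, stepAux,
        List.cons_append, List.nil_append]
      congr 2
      funext k
      cases k <;> cases b <;> simp [dat]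
    have h₃ : Reach c (2 * (b :: l).length + 2) _ _ :=
      (h.trans (ih _ _)).mono (by simp only [List.length_cons]; omega)
    simpa using h₃

theorem dat_update_main (m a x y l : List Bool) :
    Function.update (dat m a x y) .main l = dat l a x y := by
  funext k; cases k <;> simp [dat]

theorem dat_update_aux (m a x y l : List Bool) :
    Function.update (dat m a x y) .aux l = dat m l x y := by
  funext k; cases k <;> simp [dat]

theorem dat_update_t₁ (m a x y l : List Bool) :
    Function.update (dat m a x y) .t₁ l = dat m a l y := by
  funext k; cases k <;> simp [dat]

theorem dat_update_t₂ (m a x y l : List Bool) :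
    Function.update (dat m a x y) .t₂ l = dat m a x l := by
  funext k; cases k <;> simp [dat]

theorem reach_move_main_t₁ (v : Val) (ks m a x y i o) :
    Reach c (2 * v.size) (mk c (.move .main .t₁ :: ks) (dat (v.ser ++ m) a x y) i o)
      (mk c ks (dat m a (v.ser.reverse ++ x) y) i o) := by
  simpa only [dat_update_main, dat_update_t₁, dat] using
    reach_move_aux (c := c) (x := .main) (y := .t₁) (by decide) v ks (dat (v.ser ++ m) a x y) m i o
      rfl

theorem reach_move_main_t₂ (v : Val) (ks m a x y i o) :
    Reach c (2 * v.size) (mk c (.move .main .t₂ :: ks) (dat (v.ser ++ m) a x y) i o)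
      (mk c ks (dat m a x (v.ser.reverse ++ y)) i o) := by
  simpa only [dat_update_main, dat_update_t₂, dat] using
    reach_move_aux (c := c) (x := .main) (y := .t₂) (by decide) v ks (dat (v.ser ++ m) a x y) m i o
      rfl

theorem reach_move_aux_t₁ (v : Val) (ks m a x y i o) :
    Reach c (2 * v.size) (mk c (.move .aux .t₁ :: ks) (dat m (v.ser ++ a) x y) i o)
      (mk c ks (dat m a (v.ser.reverse ++ x) y) i o) := by
  simpa only [dat_update_aux, dat_update_t₁, dat] using
    reach_move_aux (c := c) (x := .aux) (y := .t₁) (by decide) v ks (dat m (v.ser ++ a) x y) a i o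
      rfl

theorem reach_pour_t₁_main (l : List Bool) (ks m a y i o) :
    Reach c (2 * l.length + 2) (mk c (.pour .t₁ .main :: ks) (dat m a l y) i o)
      (mk c ks (dat (l.reverse ++ m) a [] y) i o) := by
  simpa only [dat_update_main, dat_update_t₁, dat] using
    reach_pour_aux (c := c) (x := .t₁) (y := .main) (by decide) l ks (dat m a l y) i o rfl

theorem reach_pour_t₁_aux (l : List Bool) (ks m a y i o) :
    Reach c (2 * l.length + 2) (mk c (.pour .t₁ .aux :: ks) (dat m a l y) i o)
      (mk c ks (dat m (l.reverse ++ a) [] y) i o) := by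
  simpa only [dat_update_aux, dat_update_t₁, dat] using
    reach_pour_aux (c := c) (x := .t₁) (y := .aux) (by decide) l ks (dat m a l y) i o rfl

theorem reach_pour_t₂_main (l : List Bool) (ks m a x i o) :
    Reach c (2 * l.length + 2) (mk c (.pour .t₂ .main :: ks) (dat m a x l) i o)
      (mk c ks (dat (l.reverse ++ m) a x []) i o) := by
  simpa only [dat_update_main, dat_update_t₂, dat] using
    reach_pour_aux (c := c) (x := .t₂) (y := .main) (by decide) l ks (dat m a x l) i o rfl

theorem reach_pour_t₂_t₁ (l : List Bool) (ks m a x i o) :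
    Reach c (2 * l.length + 2) (mk c (.pour .t₂ .t₁ :: ks) (dat m a x l) i o)
      (mk c ks (dat m a (l.reverse ++ x) []) i o) := by
  simpa only [dat_update_t₁, dat_update_t₂, dat] using
    reach_pour_aux (c := c) (x := .t₂) (y := .t₁) (by decide) l ks (dat m a x l) i o rfl

theorem reach_dup (v : Val) (ks m a i o) :
    Reach c (8 * v.size + 6) (mk c (dupTasks ++ ks) (dat (v.ser ++ m) a [] []) i o)
      (mk c ks (dat (v.ser ++ (v.ser ++ m)) a [] []) i o) := by
  have h₁ := reach_move_main_t₁ (c := c) v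
    (.pour₂ :: .pour .t₂ .t₁ :: .pour .t₁ .main :: ks) m a [] [] i o
  have h₂ := reach_pour₂ (c := c) (v.ser.reverse ++ [])
    (.pour .t₂ .t₁ :: .pour .t₁ .main :: ks) m a [] i o
  have h₃ := reach_pour_t₂_t₁ (c := c) ((v.ser.reverse ++ []).reverse ++ [])
    (.pour .t₁ .main :: ks) ((v.ser.reverse ++ []).reverse ++ m) a [] i o
  have h₄ := reach_pour_t₁_main (c := c) (((v.ser.reverse ++ []).reverse ++ []).reverse ++ [])
    ks ((v.ser.reverse ++ []).reverse ++ m) a [] i o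
  have h := ((h₁.trans h₂).trans h₃).trans h₄
  simp only [List.append_nil, List.reverse_reverse, List.length_reverse, Val.length_ser] at h
  exact h.mono (by omega)

theorem reach_swap (v w : Val) (ks m a i o) :
    Reach c (4 * v.size + 4 * w.size + 4)
      (mk c (swapTasks ++ ks) (dat (v.ser ++ (w.ser ++ m)) a [] []) i o)
      (mk c ks (dat (w.ser ++ (v.ser ++ m)) a [] []) i o) := by
  have h₁ := reach_move_main_t₁ (c := c) v
    (.move .main .t₂ :: .pour .t₁ .main :: .pour .t₂ .main :: ks) (w.ser ++ m) a [] [] i o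
  have h₂ := reach_move_main_t₂ (c := c) w
    (.pour .t₁ .main :: .pour .t₂ .main :: ks) m a (v.ser.reverse ++ []) [] i o
  have h₃ := reach_pour_t₁_main (c := c) (v.ser.reverse ++ [])
    (.pour .t₂ .main :: ks) m a (w.ser.reverse ++ []) i o
  have h₄ := reach_pour_t₂_main (c := c) (w.ser.reverse ++ []) ks
    ((v.ser.reverse ++ []).reverse ++ m) a [] i o
  have h := ((h₁.trans h₂).trans h₃).trans h₄
  simp only [List.append_nil, List.reverse_reverse, List.length_reverse, Val.length_ser] at h
  exact h.mono (by omega)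

theorem reach_pop_true {t : Task Code} (ht : Ok c t) (ts : List (Task Code)) (q : St' c)
    (hb : body c t = popTok c .main (ifTok c (pushTasks c ts (next c)) q)) (ks m a x y i o) :
    Reach c 2 (mk c (t :: ks) (dat (true :: m) a x y) i o)
      (mk c (ts ++ ks) (dat m a x y) i o) := by
  refine reach_of_body ht fun v => ⟨(v.1, some true, v.2.2), ?_⟩
  rw [hb, popTok_step, ifTok_step, if_pos (by simp [dat]), pushTasks_step, dat_update_main]
  rfl

theorem reach_pop_false {t : Task Code} (ht : Ok c t) (ts : List (Task Code)) (q : St' c)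
    (hb : body c t = popTok c .main (ifTok c q (pushTasks c ts (next c)))) (ks m a x y i o) :
    Reach c 2 (mk c (t :: ks) (dat (false :: m) a x y) i o)
      (mk c (ts ++ ks) (dat m a x y) i o) := by
  refine reach_of_body ht fun v => ⟨(v.1, some false, v.2.2), ?_⟩
  rw [hb, popTok_step, ifTok_step, if_neg (by simp [dat]), pushTasks_step, dat_update_main]
  rfl

theorem reach_push {t : Task Code} (ht : Ok c t) (ts : List (Task Code))
    (hb : body c t = pushTasks c ts (next c)) (ks D i o) :
    Reach c 2 (mk c (t :: ks) D i o) (mk c (ts ++ ks) D i o) := by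
  refine reach_of_body ht fun v => ⟨v, ?_⟩
  rw [hb, pushTasks_step]
  rfl

theorem ok_code {d : Code} (h : d ∈ c.subs) : Ok c (.code d) := h

/-- Structural induction, in which the remaining tasks `ks` and the lower parts `m` and `a` of the
main and auxiliary stacks are arbitrary. This lets the hypotheses apply to subprograms running on
top of unfinished work. The temporary stacks must be empty at both ends, because pouring does not
stop at the end of a tree. -/
theorem reach_code (d : Code) (hd : d ∈ c.subs) (v : Val) (ks m a i o) :
    Reach c (d.cost v) (mk c (.code d :: ks) (dat (v.ser ++ m) a [] []) i o)
      (mk c ks (dat ((d.eval v).ser ++ m) a [] []) i o) := by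
  induction d generalizing v ks m a with
  | id => exact reach_push (ok_code hd) [] rfl _ _ _ _
  | nil =>
    exact (((reach_push (ok_code hd) [.drop, .tok false] rfl _ _ _ _).trans
      (reach_drop v _ _ _ _ _ _ _)).trans (reach_tok _ _ _ _ _ _ _ _)).mono
        (by simp only [Code.cost]; omega)
  | fst =>
    cases v with
    | nil =>
      exact ((reach_pop_false (ok_code hd) [.tok false] _ rfl _ _ _ _ _ _ _).trans
        (reach_tok _ _ _ _ _ _ _ _)).mono (by simp only [Code.cost]; omega)
    | cons p q =>
      simp only [Val.ser, List.cons_append, List.append_assoc]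
      have h := ((((reach_pop_true (ok_code hd) [.move .main .t₁, .drop, .pour .t₁ .main] _ rfl ks _ a []
        [] i o).trans (reach_move_main_t₁ p _ (q.ser ++ m) _ _ _ _ _)).trans
        (reach_drop q _ _ a _ [] i o)).trans (reach_pour_t₁_main _ _ _ _ _ _ _))
      simp only [List.append_nil, List.reverse_reverse, List.length_reverse, Val.length_ser] at h
      exact h.mono (by simp only [Code.cost, Val.size]; omega)
  | snd =>
    cases v with
    | nil =>
      exact ((reach_pop_false (ok_code hd) [.tok false] _ rfl _ _ _ _ _ _ _).trans
        (reach_tok _ _ _ _ _ _ _ _)).mono (by simp only [Code.cost]; omega)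
    | cons p q =>
      simp only [Val.ser, List.cons_append, List.append_assoc]
      exact ((reach_pop_true (ok_code hd) [.drop] _ rfl ks _ _ _ _ _ _).trans
        (reach_drop p _ _ _ _ _ _ _)).mono (by simp only [Code.cost, Val.size]; omega)
  | pair f g ihf ihg =>
    have hf : f ∈ c.subs := Code.subs_trans (by simp [Code.subs, f.mem_subs_self]) hd
    have hg : g ∈ c.subs := Code.subs_trans (by simp [Code.subs, g.mem_subs_self]) hd
    have h₁ := reach_push (ok_code hd) (dupTasks ++ .code g :: (swapTasks ++ [.code f, .tok true])) rfl ks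
      (dat (v.ser ++ m) a [] []) i o
    simp only [List.append_assoc, List.cons_append, List.nil_append] at h₁
    -- The second component is computed first, since it must lie below the first one; a final token
    -- `true` turns the two top trees into a pair.
    have h := ((((h₁.trans (reach_dup v _ _ _ _ _)).trans (ihg hg _ _ _ _)).trans
      (reach_swap _ _ _ _ _ _ _)).trans (ihf hf _ _ _ _)).trans (reach_tok _ _ _ _ _ _ _ _)
    simp only [Code.eval, Val.ser, List.cons_append, List.append_assoc]
    exact h.mono (by simp only [Code.cost]; omega)
  | comp f g ihf ihg =>
    have hf : f ∈ c.subs := Code.subs_trans (by simp [Code.subs, f.mem_subs_self]) hd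
    have hg : g ∈ c.subs := Code.subs_trans (by simp [Code.subs, g.mem_subs_self]) hd
    exact (((reach_push (ok_code hd) [.code g, .code f] rfl ks _ i o).trans (ihg hg _ _ _ _)).trans
      (ihf hf _ _ _ _)).mono (by simp only [Code.cost]; omega)
  | fold f ih =>
    have hf : f ∈ c.subs := Code.subs_trans (by simp [Code.subs, f.mem_subs_self]) hd
    -- The auxiliary stack holds the part of the list not yet consumed, above the lists `a` of the
    -- enclosing folds.
    have loop (l s : Val) (ks m a) :
        Reach c (Val.foldCost (fun h s => f.eval (.cons h s)) (fun h s => f.cost (.cons h s)) l s)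
          (mk c (.loop f :: ks) (dat (s.ser ++ m) (l.ser ++ a) [] []) i o)
          (mk c ks (dat ((Val.fold (fun h s => f.eval (.cons h s)) l s).ser ++ m) a [] []) i o) := by
      induction l generalizing s ks m a with
      | nil =>
        refine reach_of_body (t := .loop f) hf fun v => ⟨(v.1, some false, v.2.2), ?_⟩
        rw [body, popTok_step, ifTok_step, if_neg (by simp [dat, Val.ser]), dat_update_aux]
        rfl
      | cons p q _ ihq =>
        have h₁ : Reach c 2
            (mk c (.loop f :: ks) (dat (s.ser ++ m) ((Val.cons p q).ser ++ a) [] []) i o)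
            (mk c (.move .aux .t₁ :: .pour .t₁ .main :: .tok true :: .code f :: .loop f :: ks)
              (dat (s.ser ++ m) (p.ser ++ (q.ser ++ a)) [] []) i o) := by
          refine reach_of_body (t := .loop f) hf fun v => ⟨(v.1, some true, v.2.2), ?_⟩
          rw [body, popTok_step, ifTok_step, if_pos (by simp [dat, Val.ser]), pushTasks_step,
            dat_update_aux]
          simp only [Val.ser, dat, List.cons_append, List.tail_cons, List.append_assoc]
          rfl
        have h₂ := ((h₁.trans (reach_move_aux_t₁ p _ _ _ _ _ _ _)).trans
          (reach_pour_t₁_main _ _ _ _ _ _ _)).trans (reach_tok _ _ _ _ _ _ _ _)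
        simp only [List.append_nil, List.reverse_reverse, List.length_reverse, Val.length_ser] at h₂
        have e : true :: (p.ser ++ (s.ser ++ m)) = (Val.cons p s).ser ++ m := by simp [Val.ser]
        rw [e] at h₂
        exact ((h₂.trans (ih hf _ _ _ _)).trans (ihq _ _ _ _)).mono
          (by simp only [Val.foldCost]; omega)
    cases v with
    | nil =>
      exact ((reach_pop_false (ok_code hd) [.tok false] _ rfl _ _ _ _ _ _ _).trans
        (reach_tok _ _ _ _ _ _ _ _)).mono (by simp only [Code.cost]; omega)
    | cons l s =>
      simp only [Val.ser, List.cons_append, List.append_assoc]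
      have h := ((reach_pop_true (ok_code hd) [.move .main .t₁, .pour .t₁ .aux, .loop f] _ rfl ks _ a []
        [] i o).trans (reach_move_main_t₁ l _ (s.ser ++ m) _ _ _ _ _)).trans
        (reach_pour_t₁_aux _ _ _ _ _ _ _)
      simp only [List.append_nil, List.reverse_reverse, List.length_reverse, Val.length_ser] at h
      exact (h.trans (loop l s _ _ _)).mono (by simp only [Code.cost]; omega)

end Machine
end FairDivision
end

/-! ### Input, output and the complete Turing machine -/

noncomputable section
namespace FairDivision
open Computability (Γ')
open Turing.TM2 (Stmt stepAux)

/-- The tree that represents a truth value. -/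
def boolVal (b : Bool) : Val := bif b then .cons .nil .nil else .nil

namespace Machine
variable {c : Code}

theorem reach_sym (s : Γ') (ks m a x y i o) :
    Reach c 2 (mk c (.sym s :: ks) (dat m a x y) i o)
      (mk c ks (dat (true :: ((symVal s).ser ++ m)) a x y) i o) := by
  refine reach_of_body (by exact trivial) fun v => ⟨v, ?_⟩
  rw [body, pushToks_step, List.cons_append]
  rfl

/-- Each symbol read is consed in front of the tree built so far, so the word ends up reversed. The
reversal is compensated in `inP_of_polyTime`. -/
theorem reach_input (w w' : List Γ') (ks a x y o) :
    Reach c (4 * w.length + 2) (mk c (.input :: ks) (dat (wordVal w').ser a x y) w o)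
      (mk c ks (dat (wordVal (w.reverse ++ w')).ser a x y) [] o) := by
  induction w generalizing w' with
  | nil =>
    refine reach_of_body (by exact trivial) fun v => ⟨(v.1, v.2.1, none), ?_⟩
    rw [body, stepAux, stepAux]
    simp only [mk, List.head?_nil, Option.isSome_none, cond_false, stepAux, List.tail_nil,
      List.reverse_nil, List.nil_append]
    congr 1
    funext k
    rcases k with _ | _ | _ | d <;> simp [mk]
  | cons s w ih =>
    have h : Reach c 2 (mk c (.input :: ks) (dat (wordVal w').ser a x y) (s :: w) o)
        (mk c (.sym s :: .input :: ks) (dat (wordVal w').ser a x y) w o) := by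
      refine reach_of_body (by exact trivial) fun v => ⟨(v.1, v.2.1, some s), ?_⟩
      rw [body, stepAux, stepAux]
      have e : Function.update (mk c ks (dat (wordVal w').ser a x y) (s :: w) o) .inp
          (mk c ks (dat (wordVal w').ser a x y) (s :: w) o .inp).tail
          = mk c ks (dat (wordVal w').ser a x y) w o := by
        funext k
        rcases k with _ | _ | _ | d <;> simp [mk]
      rw [e, pushTasks_step]
      simp only [mk, List.head?_cons, Option.isSome_some, cond_true, stepAux]
      congr 1
      funext k
      rcases k with _ | _ | _ | d <;> simp [mk, Task.map]
    have h' := (h.trans (reach_sym s _ _ _ _ _ _ _)).trans (ih (s :: w'))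
    simp only [List.reverse_cons, List.append_assoc, List.cons_append, List.nil_append,
      List.length_cons]
    exact h'.mono (by omega)

theorem reach_output (b : Bool) :
    Reach c 6 (mk c [.output] (dat (boolVal b).ser [] [] []) [] [])
      (mk c [] (dat [] [] [] []) [] [b]) := by
  cases b with
  | false =>
    refine Reach.mono (n := 2) (reach_of_body (by exact trivial)
      fun v => ⟨(v.1, some false, v.2.2), ?_⟩) (by omega)
    rw [body, popTok_step, ifTok_step, if_neg (by simp [dat, boolVal, Val.ser]), dat_update_main]
    simp only [stepAux, dat, boolVal, Val.ser, cond_false, List.tail_cons, List.head?_cons]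
    congr 1
    funext k
    rcases k with _ | _ | _ | d <;> simp [mk]
  | true =>
    have h : Reach c 2 (mk c [.output] (dat (boolVal true).ser [] [] []) [] [])
        (mk c [.drop, .drop] (dat (Val.nil.ser ++ (Val.nil.ser ++ [])) [] [] []) [] [true]) := by
      refine reach_of_body (by exact trivial) fun v => ⟨(v.1, some true, v.2.2), ?_⟩
      rw [body, popTok_step, ifTok_step, if_pos (by simp [dat, boolVal, Val.ser]), dat_update_main,
        stepAux]
      have e (D : DataStk → List Bool) :
          Function.update (mk c [] D [] []) .out
            (true :: mk c [] D [] [] .out) = mk c [] D [] [true] := by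
        funext k
        rcases k with _ | _ | _ | d <;> simp [mk]
      rw [e, pushTasks_step]
      rfl
    exact (h.trans (reach_drop _ _ _ _ _ _ _ _)).trans (reach_drop _ _ _ _ _ _ _ _)

instance : Finite (Task c.Sub) := by
  have : Finite c.Sub := List.finite_toSet c.subs
  have : Fintype c.Sub := Fintype.ofFinite _
  exact Finite.of_fintype _

instance : Fintype (Task c.Sub) := Fintype.ofFinite _

/-- The machine that runs the program `c` on the reversal of the input word. -/
def machine (c : Code) : Turing.FinTM2 where
  K := Stk
  k₀ := .inp
  k₁ := .out
  Γ := Alph c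
  Λ := Lab c
  main := some .start
  σ := St c
  initialState := (none, none, none)
  Γk₀Fin := inferInstanceAs (Fintype Γ')
  m := prog c

theorem machine_outputs (c : Code) (w : List Γ') (b : Bool)
    (h : c.eval (wordVal w.reverse) = boolVal b) :
    Nonempty (Turing.TM2OutputsInTime (machine c) w (some [b])
      (c.cost (wordVal w.reverse) + 4 * w.length + 12)) := by
  have h₁ := reach_tok (c := c) false [.input, .code c, .output] [] [] [] [] w []
  have h₂ := h₁.trans (reach_input w [] _ _ _ _ _)
  rw [List.append_nil, ← List.append_nil (wordVal w.reverse).ser] at h₂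
  have h₃ := h₂.trans (reach_code c c.mem_subs_self _ _ _ _ _ _)
  rw [h, List.append_nil] at h₃
  obtain ⟨k, hk, v, e⟩ := h₃.trans (reach_output b) (none, none, none)
  have e₀ : Turing.TM2.step (prog c) (Turing.initList (machine c) w)
      = some ⟨some none, (none, none, none),
          mk c [.tok false, .input, .code c, .output] (dat [] [] [] []) w []⟩ := by
    have : (Turing.initList (machine c) w).stk = mk c [] (dat [] [] [] []) w [] := by
      funext k
      rcases k with _ | _ | _ | d
      · rfl
      · rfl
      · rfl
      · cases d <;> rfl
    have e' : Turing.initList (machine c) w = ⟨some (some .start), (none, none, none),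
        mk c [] (dat [] [] [] []) w []⟩ := by rw [← this]; rfl
    rw [e']
    change some (stepAux (body c .start) _ _) = _
    rw [body, pushTasks_step]
    rfl
  -- An empty control stack triggers the halt. The registers are reset first, because the prescribed
  -- final configuration has the initial internal state.
  have e₁ : Turing.TM2.step (prog c) ⟨some none, v, mk c [] (dat [] [] [] []) [] [b]⟩
      = some (Turing.haltList (machine c) [b]) := by
    have : (Turing.haltList (machine c) [b]).stk = mk c [] (dat [] [] [] []) [] [b] := by
      funext k
      rcases k with _ | _ | _ | d
      · rfl
      · rfl
      · rfl
      · cases d <;> rfl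
    have e' : Turing.haltList (machine c) [b] = ⟨none, (none, none, none),
        mk c [] (dat [] [] [] []) [] [b]⟩ := by rw [← this]; rfl
    rw [e']
    change some (stepAux (prog c none) v _) = _
    simp only [prog, stepAux, mk, List.map_nil, List.head?_nil, Option.isSome_none, cond_false,
      List.tail_nil]
    congr 2
    funext k
    rcases k with _ | _ | _ | d <;> simp [mk]
  have e₂ : (flip bind (machine c).step)^[k + 1] (some (Turing.initList (machine c) w))
      = some ⟨some none, v, mk c [] (dat [] [] [] []) [] [b]⟩ := by
    rw [Function.iterate_succ_apply]
    exact (congrArg _ e₀).trans e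
  -- One step for the initial `start` label, `k` for the tasks, one for halting.
  refine ⟨⟨⟨1 + (k + 1), ?_⟩, show 1 + (k + 1) ≤ _ by omega⟩⟩
  rw [Function.iterate_add_apply, e₂]
  exact e₁

end Machine

theorem inP_of_code {L : Language Γ'} (c : Code) (f : List Γ' → Bool)
    (hf : ∀ w, f w = true ↔ w ∈ L) (hc : ∀ w, c.eval (wordVal w.reverse) = boolVal (f w))
    (p : Polynomial ℕ) (hp : ∀ w : List Γ', c.cost (wordVal w.reverse) ≤ p.eval w.length) :
    InP L := by
  classical
  refine ⟨{ tm := Machine.machine c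
            inputAlphabet := Equiv.refl _
            outputAlphabet := Equiv.refl _
            time := p + 4 * Polynomial.X + 12
            outputsFun := fun w => ?_ }, ?_⟩
  · have hd : f w = decide (w ∈ L) := by
      by_cases h : w ∈ L
      · simp [h, (hf w).2 h]
      · simpa [h] using fun h' => h ((hf w).1 h')
    have h := (Machine.machine_outputs c w _ (hc w)).some
    rw [hd] at h
    have e₁ : (List.map (Equiv.refl Γ').invFun w) = w := List.map_id w
    have e₂ : ∀ b : Bool, (List.map (Equiv.refl Bool).invFun (Computability.encodeBool b)) = [b] :=
      fun b => rfl
    refine ⟨⟨h.steps, ?_⟩, h.steps_le_m.trans ?_⟩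
    · have := h.evals_in_steps
      convert this using 2
      · exact congrArg _ (congrArg _ e₁)
      · exact congrArg _ (e₂ _)
    · simp only [Polynomial.eval_add, Polynomial.eval_mul, Polynomial.eval_X, id_eq,
        Polynomial.eval_ofNat]
      have := hp w
      omega
  · rintro (_ | _ | _ | d)
    · exact inferInstanceAs (Finite (Task c.Sub))
    · exact inferInstanceAs (Finite Γ')
    · exact inferInstanceAs (Finite Bool)
    · exact inferInstanceAs (Finite Bool)

end FairDivision
end

noncomputable section
namespace FairDivision
open Computability (Γ')

/-! ### Polynomial-time functions between encoded types -/

/-- Types whose elements are represented by trees. -/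
class Enc (α : Type) where
  /-- The tree that represents an element. -/
  enc : α → Val

open Enc (enc)

variable {α β γ δ σ : Type} [Enc α] [Enc β] [Enc γ] [Enc δ] [Enc σ]

instance : Enc Unit := ⟨fun _ => .nil⟩
instance : Enc Bool := ⟨boolVal⟩
instance : Enc (α × β) := ⟨fun p => .cons (enc p.1) (enc p.2)⟩

/-- The tree that represents a list. -/
def listVal : List α → Val
  | [] => .nil
  | a :: l => .cons (enc a) (listVal l)

instance : Enc (List α) := ⟨listVal⟩
instance : Enc ℕ := ⟨fun n => enc n.bits⟩
instance : Enc Γ' := ⟨fun s => enc (symIdx s)⟩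

/-- The size of the representation of an element. -/
def sz (a : α) : ℕ := (enc a).size

theorem one_le_sz (a : α) : 1 ≤ sz a := Val.one_le_size _

@[simp] theorem sz_mk (a : α) (b : β) : sz (a, b) = sz a + sz b + 1 := rfl
@[simp] theorem sz_nil : sz ([] : List α) = 1 := rfl
@[simp] theorem sz_cons (a : α) (l : List α) : sz (a :: l) = sz a + sz l + 1 := rfl
@[simp] theorem sz_false : sz false = 1 := rfl
@[simp] theorem sz_true : sz true = 3 := rfl
theorem sz_bool_le (b : Bool) : sz b ≤ 3 := by cases b <;> decide

theorem sz_append (l l' : List α) : sz (l ++ l') + 1 = sz l + sz l' := by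
  induction l with
  | nil => simp; omega
  | cons a l ih => simp only [List.cons_append, sz_cons]; omega

theorem length_lt_sz (l : List α) : l.length < sz l := by
  induction l with
  | nil => simp
  | cons a l ih => simp; omega

theorem sz_reverse (l : List α) : sz l.reverse = sz l := by
  induction l with
  | nil => rfl
  | cons a l ih =>
    have := sz_append l.reverse [a]
    simp at this ⊢
    omega

theorem sz_prefix_le {l l' : List α} (h : l' <+: l) : sz l' ≤ sz l := by
  obtain ⟨t, rfl⟩ := h
  have := sz_append l' t
  have := one_le_sz t
  omega

theorem eval_mono (p : Polynomial ℕ) {m n : ℕ} (h : m ≤ n) : p.eval m ≤ p.eval n := by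
  induction p using Polynomial.induction_on' with
  | add p q hp hq => simpa using Nat.add_le_add hp hq
  | monomial k a => simp only [Polynomial.eval_monomial]; gcongr

/-- A function is bounded by a polynomial in the size of its argument. -/
def PolyBdd (f : α → ℕ) : Prop := ∃ p : Polynomial ℕ, ∀ a, f a ≤ p.eval (sz a)

theorem PolyBdd.mono {f g : α → ℕ} (hg : PolyBdd g) (h : ∀ a, f a ≤ g a) : PolyBdd f := by
  obtain ⟨p, hp⟩ := hg
  exact ⟨p, fun a => (h a).trans (hp a)⟩

theorem PolyBdd.const (n : ℕ) : PolyBdd fun _ : α => n := ⟨Polynomial.C n, by simp⟩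

theorem PolyBdd.add {f g : α → ℕ} (hf : PolyBdd f) (hg : PolyBdd g) :
    PolyBdd fun a => f a + g a := by
  obtain ⟨p, hp⟩ := hf
  obtain ⟨q, hq⟩ := hg
  exact ⟨p + q, fun a => by simpa using Nat.add_le_add (hp a) (hq a)⟩

theorem PolyBdd.mul {f g : α → ℕ} (hf : PolyBdd f) (hg : PolyBdd g) :
    PolyBdd fun a => f a * g a := by
  obtain ⟨p, hp⟩ := hf
  obtain ⟨q, hq⟩ := hg
  exact ⟨p * q, fun a => by simpa using Nat.mul_le_mul (hp a) (hq a)⟩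

theorem PolyBdd.sz : PolyBdd fun a : α => sz a := ⟨Polynomial.X, by simp⟩

theorem PolyBdd.comp {f : β → ℕ} {g : α → β} (hf : PolyBdd f)
    (hg : PolyBdd fun a => FairDivision.sz (g a)) : PolyBdd fun a => f (g a) := by
  obtain ⟨p, hp⟩ := hf
  obtain ⟨q, hq⟩ := hg
  exact ⟨p.comp q, fun a => by
    simpa using (hp (g a)).trans (eval_mono p (hq a))⟩

/-- The cost pays for everything that is written. Hence polynomial time already bounds the size of
outputs, and composition needs no separate size hypothesis. -/
theorem Code.size_eval_le (c : Code) (v : Val) : (c.eval v).size ≤ v.size + c.cost v := by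
  induction c generalizing v with
  | id => simp [eval]
  | nil => simp [eval, Val.size, cost]; omega
  | fst => cases v <;> simp [eval, Val.size, cost]; omega
  | snd => cases v <;> simp [eval, Val.size, cost]; omega
  | pair f g ihf ihg =>
    have := ihf v
    have := ihg v
    simp only [eval, Val.size, cost]
    omega
  | comp f g ihf ihg =>
    have := ihf (g.eval v)
    have := ihg v
    simp only [eval, cost]
    omega
  | fold f ih =>
    have loop (l s : Val) : (Val.fold (fun h s => f.eval (.cons h s)) l s).size ≤ s.size +
        Val.foldCost (fun h s => f.eval (.cons h s)) (fun h s => f.cost (.cons h s)) l s := by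
      induction l generalizing s with
      | nil => simp [Val.fold]
      | cons p q _ ihq =>
        have := ih (.cons p s)
        have := ihq (f.eval (.cons p s))
        simp only [Val.fold, Val.foldCost, Val.size] at *
        omega
    cases v with
    | nil => simp [eval]
    | cons l s =>
      have := loop l s
      simp only [eval, cost, Val.size]
      omega

/-- A function between encoded types is computed by a program in polynomial time. -/
@[fun_prop]
def PolyTime (f : α → β) : Prop :=
  ∃ c : Code, (∀ a, c.eval (enc a) = enc (f a)) ∧ PolyBdd fun a : α => c.cost (enc a)

namespace PolyTime

theorem polyBdd {f : α → β} (hf : PolyTime f) : PolyBdd fun a => sz (f a) := by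
  obtain ⟨c, hc, hp⟩ := hf
  refine (PolyBdd.sz.add hp).mono fun a => ?_
  rw [sz, ← hc]
  exact c.size_eval_le _

theorem recode (f : α → β) (h : ∀ a, enc (f a) = enc a) : PolyTime f :=
  ⟨.id, fun a => by simp [Code.eval, h], PolyBdd.const 2⟩

theorem of_enc_eq {f : α → γ} {g : α → β} (hg : PolyTime g) (h : ∀ a, enc (f a) = enc (g a)) :
    PolyTime f := by
  obtain ⟨c, hc, hp⟩ := hg
  exact ⟨c, fun a => by rw [hc, h], hp⟩

@[fun_prop]
theorem id : PolyTime fun a : α => a := recode _ fun _ => rfl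

@[fun_prop]
theorem comp {f : β → γ} {g : α → β} (hf : PolyTime f) (hg : PolyTime g) :
    PolyTime fun a => f (g a) := by
  have hs := hg.polyBdd
  obtain ⟨c, hc, hp⟩ := hf
  obtain ⟨d, hd, hq⟩ := hg
  refine ⟨.comp c d, fun a => by simp [Code.eval, hd, hc], ?_⟩
  refine ((hq.add (hp.comp hs)).add (.const 2)).mono fun a => ?_
  simp [Code.cost, hd]

@[fun_prop]
theorem const (b : β) : PolyTime fun _ : α => b := by
  have (v : Val) : ∃ c : Code, (∀ w, c.eval w = v) ∧
      PolyBdd fun a : α => c.cost (enc a) := by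
    induction v with
    | nil =>
      exact ⟨.nil, fun _ => rfl, ((PolyBdd.const 20).mul PolyBdd.sz).add (.const 20)⟩
    | cons p q ihp ihq =>
      obtain ⟨c, hc, hp⟩ := ihp
      obtain ⟨d, hd, hq⟩ := ihq
      refine ⟨.pair c d, fun w => by simp [Code.eval, hc, hd], ?_⟩
      refine (((hq.add hp).add ((PolyBdd.const 20).mul (PolyBdd.sz.add (.const q.size)))).add
        (.const 20)).mono fun a => ?_
      simp [Code.cost, hd, sz]
  obtain ⟨c, hc, hp⟩ := this (enc b)
  exact ⟨c, fun a => hc _, hp⟩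

@[fun_prop]
theorem pair {f : α → β} {g : α → γ} (hf : PolyTime f) (hg : PolyTime g) :
    PolyTime fun a => (f a, g a) := by
  have hs := hg.polyBdd
  obtain ⟨c, hc, hp⟩ := hf
  obtain ⟨d, hd, hq⟩ := hg
  refine ⟨.pair c d, fun a => by simp [Code.eval, hd, hc, enc], ?_⟩
  refine (((hq.add hp).add ((PolyBdd.const 20).mul (PolyBdd.sz.add hs))).add
    (.const 20)).mono fun a => ?_
  simp [Code.cost, hd, sz]

theorem fst' : PolyTime fun p : α × β => p.1 :=
  ⟨.fst, fun _ => rfl, ((PolyBdd.const 20).mul PolyBdd.sz).add (.const 20)⟩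

theorem snd' : PolyTime fun p : α × β => p.2 :=
  ⟨.snd, fun _ => rfl, ((PolyBdd.const 20).mul PolyBdd.sz).add (.const 20)⟩

@[fun_prop]
theorem fst {f : α → β × γ} (hf : PolyTime f) : PolyTime fun a => (f a).1 := fst'.comp hf

@[fun_prop]
theorem snd {f : α → β × γ} (hf : PolyTime f) : PolyTime fun a => (f a).2 := snd'.comp hf

theorem fold_enc {F : Val → Val → Val} {f : σ → α → σ}
    (h : ∀ s a, F (enc a) (enc s) = enc (f s a)) (l : List α) (s : σ) :
    Val.fold F (enc l) (enc s) = enc (l.foldl f s) := by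
  induction l generalizing s with
  | nil => rfl
  | cons a l ih =>
    change Val.fold F (enc l) (F (enc a) (enc s)) = _
    rw [h, ih]
    rfl

theorem foldCost_enc {F : Val → Val → Val} {C : Val → Val → ℕ} {f : σ → α → σ}
    (h : ∀ s a, F (enc a) (enc s) = enc (f s a)) (K : ℕ) (l : List α) (s : σ)
    (hK : ∀ l' a, l' ++ [a] <+: l → 20 * sz a + 20 + C (enc a) (enc (l'.foldl f s)) ≤ K) :
    Val.foldCost F C (enc l) (enc s) ≤ l.length * K + 2 := by
  induction l generalizing s with
  | nil => simp [enc, listVal, Val.foldCost]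
  | cons a l ih =>
    have h₁ := hK [] a (by simp)
    have h₂ := ih (f s a) fun l' b hl' => hK (a :: l') b (by simpa using hl')
    change 20 * sz a + 20 + C (enc a) (enc s) + Val.foldCost F C (enc l) (F (enc a) (enc s)) ≤ _
    rw [h, List.length_cons, Nat.add_mul, Nat.one_mul]
    simp only [List.foldl_nil] at h₁
    omega

/-- Bounded recursion: there are at most as many rounds as list entries, and each costs a polynomial
in the size of the current state. The hypothesis `h` on prefixes is essential, since iterating a
polynomial-time step could otherwise make the state grow exponentially. -/
theorem foldl {l : γ → List α} {s : γ → σ} {f : γ → σ → α → σ} (hl : PolyTime l)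
    (hs : PolyTime s) (hf : PolyTime fun p : γ × σ × α => f p.1 p.2.1 p.2.2) (B : γ → ℕ)
    (hB : PolyBdd B) (h : ∀ c l', l' <+: l c → sz (l'.foldl (f c) (s c)) ≤ B c) :
    PolyTime fun c => (l c).foldl (f c) (s c) := by
  -- The body of a program fold sees only the entry and the accumulator, so the parameter `c` is
  -- carried along unchanged in the accumulator.
  have step : PolyTime fun p : α × γ × σ => (p.2.1, f p.2.1 p.2.2 p.1) :=
    (fst'.comp snd').pair
      (hf.comp ((fst'.comp snd').pair ((snd'.comp snd').pair fst')))
  obtain ⟨d, hd, P, hP⟩ := step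
  have key (c : γ) (l' : List α) (t : σ) :
      l'.foldl (fun (s : γ × σ) a => (s.1, f s.1 s.2 a)) (c, t) = (c, l'.foldl (f c) t) := by
    induction l' generalizing t with
    | nil => rfl
    | cons a l' ih => simp [ih]
  have main : PolyTime fun c => (l c).foldl (fun (s : γ × σ) a => (s.1, f s.1 s.2 a)) (c, s c) := by
    obtain ⟨e, he, Q⟩ := hl.pair ((id (α := γ)).pair hs)
    have hF : ∀ (s : γ × σ) (a : α), d.eval (.cons (enc a) (enc s)) = enc (s.1, f s.1 s.2 a) :=
      fun s a => hd (a, s)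
    have hX : PolyBdd fun c => sz (l c) + sz c + B c + 2 :=
      ((hl.polyBdd.add PolyBdd.sz).add hB).add (.const 2)
    have hPX : PolyBdd fun c => P.eval (sz (l c) + sz c + B c + 2) := by
      obtain ⟨R, hR⟩ := hX
      exact ⟨P.comp R, fun c => by simpa using eval_mono P (hR c)⟩
    refine ⟨.comp (.fold d) e, fun c => ?_, ?_⟩
    · simp only [Code.eval, he]
      exact fold_enc hF _ _
    · refine (Q.add (((((PolyBdd.const 20).mul hl.polyBdd).add (.const 20)).add
        ((hl.polyBdd.mul (((PolyBdd.const 20).mul hl.polyBdd).add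
          ((PolyBdd.const 20).add hPX))).add (.const 2))).add (.const 2))).mono fun c => ?_
      simp only [Code.cost, he]
      change _ + Code.cost (.fold d) (.cons (enc (l c)) (enc (c, s c))) + 2 ≤ _
      rw [Code.cost]
      have := foldCost_enc (C := fun h s => d.cost (.cons h s)) (F := fun h s => d.eval (.cons h s))
        hF (20 * sz (l c) + (20 + P.eval (sz (l c) + sz c + B c + 2))) (l c) (c, s c) (by
          intro l' a hl'
          rw [key]
          have h₁ : l' <+: l c := (List.prefix_append _ _).trans hl'
          have h₂ := sz_prefix_le hl'
          have h₃ := sz_append l' [a]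
          have h₄ := one_le_sz l'
          simp only [sz_cons, sz_nil] at h₃
          have h₅ : d.cost (enc (a, c, l'.foldl (f c) (s c))) ≤ _ :=
            (hP (a, c, l'.foldl (f c) (s c))).trans (eval_mono P (n := sz (l c) + sz c +
            B c + 2) (by have := h c l' h₁; simp only [sz_mk]; omega))
          change 20 * sz a + 20 + d.cost (enc (a, c, l'.foldl (f c) (s c))) ≤ _
          omega)
      have h₆ := Nat.mul_le_mul_right (20 * sz (l c) + (20 + P.eval (sz (l c) + sz c + B c + 2)))
        (length_lt_sz (l c)).le
      simp only [sz] at *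
      omega
  have := snd'.comp main
  refine of_enc_eq this fun c => ?_
  rw [key]

end PolyTime
end FairDivision
end

/-! ### Polynomial-time operations on lists, truth values and binary numbers -/

noncomputable section
namespace FairDivision
open Computability (Γ')
open Enc (enc)
variable {α β γ δ σ : Type} [Enc α] [Enc β] [Enc γ] [Enc δ] [Enc σ]
namespace PolyTime

@[fun_prop]
theorem cons {f : γ → α} {l : γ → List α} (hf : PolyTime f) (hl : PolyTime l) :
    PolyTime fun c => f c :: l c :=
  of_enc_eq (hf.pair hl) fun _ => rfl

@[fun_prop]
theorem tail {l : γ → List α} (hl : PolyTime l) : PolyTime fun c => (l c).tail := by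
  have : PolyTime fun l : List α => l.tail :=
    ⟨.snd, fun l => by cases l <;> rfl, ((PolyBdd.const 20).mul PolyBdd.sz).add (.const 20)⟩
  exact this.comp hl

@[fun_prop]
theorem isEmpty {l : γ → List α} (hl : PolyTime l) : PolyTime fun c => (l c).isEmpty := by
  have := foldl (s := fun _ => true) (f := fun _ _ _ => false) hl (const _) (by fun_prop)
    (fun _ => 3) (.const _) (fun c l' _ => sz_bool_le _)
  refine of_enc_eq this fun c => ?_
  have key (l : List α) : l.foldl (fun _ _ => false) false = false := by induction l <;> simp_all
  cases l c <;> simp [key]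

/-- The trees of `true` and `[()]` coincide, and so do those of `false` and `[]`. A case distinction
thus becomes a fold with at most one round. -/
theorem boolList : PolyTime fun b : Bool => (bif b then [()] else []) :=
  recode _ fun b => by cases b <;> rfl

@[fun_prop]
theorem cond {b : γ → Bool} {f g : γ → α} (hb : PolyTime b) (hf : PolyTime f) (hg : PolyTime g) :
    PolyTime fun c => bif b c then f c else g c := by
  -- The answer is read off the second component: it starts as `g c`, and the one round that takes
  -- place when `b c` holds overwrites it by `f c`.
  have := foldl (s := fun c => (f c, g c)) (f := fun _ s _ => (s.1, s.1)) (boolList.comp hb)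
    (hf.pair hg) (by fun_prop) (fun c => 2 * sz (f c) + sz (g c) + 1)
    ((((PolyBdd.const 2).mul hf.polyBdd).add hg.polyBdd).add (.const _)) (by
      intro c l' hl'
      cases hbc : b c with
      | false =>
        simp only [hbc, cond_false, List.prefix_nil] at hl'
        subst hl'
        simp
        omega
      | true =>
        simp only [hbc, cond_true] at hl'
        obtain _ | ⟨_, _ | _⟩ := l'
        · simp; omega
        · simp; omega
        · have := hl'.length_le
          simp at this)
  refine of_enc_eq (snd this) fun c => ?_
  cases b c <;> rfl

@[fun_prop]
theorem and {b b' : γ → Bool} (hb : PolyTime b) (hb' : PolyTime b') :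
    PolyTime fun c => b c && b' c :=
  of_enc_eq (hb.cond hb' (const false)) fun c => by cases b c <;> rfl

@[fun_prop]
theorem or {b b' : γ → Bool} (hb : PolyTime b) (hb' : PolyTime b') :
    PolyTime fun c => b c || b' c :=
  of_enc_eq (hb.cond (const true) hb') fun c => by cases b c <;> rfl

@[fun_prop]
theorem not {b : γ → Bool} (hb : PolyTime b) : PolyTime fun c => !(b c) :=
  of_enc_eq (hb.cond (const false) (const true)) fun c => by cases b c <;> rfl

@[fun_prop]
theorem beq_bool {b b' : γ → Bool} (hb : PolyTime b) (hb' : PolyTime b') :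
    PolyTime fun c => b c == b' c :=
  of_enc_eq (hb.cond hb' hb'.not) fun c => by cases b c <;> cases b' c <;> rfl

@[fun_prop]
theorem headD {l : γ → List α} {d : γ → α} (hl : PolyTime l) (hd : PolyTime d) :
    PolyTime fun c => (l c).headD (d c) := by
  have key (l : List α) (x : α) : l.foldl (fun (s : Bool × α) a => bif s.1 then (false, a) else s)
      (false, x) = (false, x) := by induction l <;> simp_all
  -- The flag records that no entry has been seen yet; once it is lowered, later entries leave the
  -- state unchanged.
  have := foldl (s := fun c => (true, d c)) (f := fun _ s a => bif s.1 then (false, a) else s) hl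
    (by fun_prop) (by fun_prop) (fun c => sz (d c) + sz (l c) + 4)
    ((hd.polyBdd.add hl.polyBdd).add (.const _)) (by
      intro c l' hl'
      have h := sz_prefix_le hl'
      cases l' with
      | nil => simp; omega
      | cons a l' =>
        simp only [sz_cons] at h
        simp [key]
        omega)
  refine of_enc_eq (snd this) fun c => ?_
  cases l c <;> simp [key]

theorem foldl_cons_eq (l t : List α) : l.foldl (fun s a => a :: s) t = l.reverse ++ t := by
  induction l generalizing t with
  | nil => rfl
  | cons a l ih => simp [ih]

@[fun_prop]
theorem reverse {l : γ → List α} (hl : PolyTime l) : PolyTime fun c => (l c).reverse := by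
  have := foldl (s := fun _ => []) (f := fun _ s a => a :: s) hl (const _) (by fun_prop)
    (fun c => sz (l c)) hl.polyBdd (fun c l' hl' => by
      rw [foldl_cons_eq, List.append_nil, sz_reverse]
      exact sz_prefix_le hl')
  refine of_enc_eq this fun c => ?_
  rw [foldl_cons_eq, List.append_nil]

@[fun_prop]
theorem append {l l' : γ → List α} (hl : PolyTime l) (hl' : PolyTime l') :
    PolyTime fun c => l c ++ l' c := by
  have := foldl (l := fun c => (l c).reverse) (s := l') (f := fun _ s a => a :: s) hl.reverse hl'
    (by fun_prop) (fun c => sz (l c) + sz (l' c)) (hl.polyBdd.add hl'.polyBdd) (fun c t ht => by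
      rw [foldl_cons_eq]
      have := sz_append t.reverse (l' c)
      have := sz_prefix_le ht
      rw [sz_reverse] at *
      omega)
  refine of_enc_eq this fun c => ?_
  rw [foldl_cons_eq, List.reverse_reverse]

/-! ### Natural numbers -/

@[fun_prop]
theorem bits {f : γ → ℕ} (hf : PolyTime f) : PolyTime fun c => (f c).bits :=
  of_enc_eq hf fun _ => rfl

theorem of_bits {f : γ → ℕ} (hf : PolyTime fun c => (f c).bits) : PolyTime f :=
  of_enc_eq hf fun _ => rfl

@[fun_prop]
theorem bit {b : γ → Bool} {f : γ → ℕ} (hb : PolyTime b) (hf : PolyTime f) :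
    PolyTime fun c => Nat.bit (b c) (f c) := by
  -- A zero digit must not be put in front of the empty expansion, since zero is represented by the
  -- empty list.
  have : PolyTime fun c => bif (!(b c) && (f c).bits.isEmpty) then [] else b c :: (f c).bits := by
    fun_prop
  refine of_bits (of_enc_eq this fun c => congrArg enc ?_)
  cases hb' : b c
  · by_cases h : f c = 0
    · simp [h]
    · have : (f c).bits.isEmpty = false := by
        rw [← Bool.not_eq_true, List.isEmpty_iff_length_eq_zero, Nat.size_eq_bits_len,
          Nat.size_eq_zero]
        exact h
      rw [Nat.bits_append_bit _ _ (by simp [h]), this]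
      simp
  · rw [Nat.bits_append_bit _ _ (by simp)]
    simp

@[fun_prop]
theorem bodd {f : γ → ℕ} (hf : PolyTime f) : PolyTime fun c => (f c).bodd := by
  have : PolyTime fun c => (f c).bits.headD false := by fun_prop
  refine of_enc_eq this fun c => congrArg enc ?_
  rw [Nat.bodd_eq_bits_head]
  cases (f c).bits <;> rfl

@[fun_prop]
theorem div2 {f : γ → ℕ} (hf : PolyTime f) : PolyTime fun c => (f c).div2 := by
  have : PolyTime fun c => (f c).bits.tail := by fun_prop
  refine of_bits (of_enc_eq this fun c => congrArg enc ?_)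
  rw [Nat.div2_bits_eq_tail]

end PolyTime

theorem size_lt_sz (n : ℕ) : n.size < sz n := by
  rw [← Nat.size_eq_bits_len]
  exact length_lt_sz n.bits

theorem sz_bits_le (l : List Bool) : sz l ≤ 4 * l.length + 1 := by
  induction l with
  | nil => simp
  | cons b l ih =>
    have := sz_bool_le b
    simp only [sz_cons, List.length_cons]
    omega

theorem sz_nat_le (n : ℕ) : sz n ≤ 4 * n.size + 1 := by
  rw [← Nat.size_eq_bits_len]
  exact sz_bits_le n.bits

theorem sz_nat_le_of_lt {n k : ℕ} (h : n < 2 ^ k) : sz n ≤ 4 * k + 1 := by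
  have := sz_nat_le n
  have := Nat.size_le.2 h
  omega

theorem sz_nat_le_of_le {m n : ℕ} (h : m ≤ n) : sz m ≤ 4 * sz n + 1 := by
  have := sz_nat_le m
  have := Nat.size_le_size h
  have := size_lt_sz n
  omega

/-- The number with the given binary digits, most significant digit first. -/
def ofDigits (l : List Bool) : ℕ := l.foldl (fun n b => Nat.bit b n) 0

theorem foldl_bit (l : List Bool) (m : ℕ) :
    l.foldl (fun n b => Nat.bit b n) m = m * 2 ^ l.length + ofDigits l := by
  induction l generalizing m with
  | nil => simp [ofDigits]
  | cons b l ih =>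
    simp only [ofDigits, List.foldl_cons]
    rw [ih, ih (Nat.bit b 0), List.length_cons, pow_succ]
    cases b <;> simp [Nat.bit] <;> ring

theorem ofDigits_cons (b : Bool) (l : List Bool) :
    ofDigits (b :: l) = b.toNat * 2 ^ l.length + ofDigits l := by
  rw [ofDigits, List.foldl_cons, foldl_bit]
  cases b <;> simp [Nat.bit]

theorem ofDigits_lt (l : List Bool) : ofDigits l < 2 ^ l.length := by
  induction l with
  | nil => simp [ofDigits]
  | cons b l ih =>
    rw [ofDigits_cons, List.length_cons, pow_succ]
    cases b <;> simp <;> omega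

theorem ofDigits_reverse_bits (n : ℕ) : ofDigits n.bits.reverse = n := by
  induction n using Nat.binaryRec' with
  | zero => simp [ofDigits]
  | bit b n hn ih =>
    rw [Nat.bits_append_bit _ _ hn, List.reverse_cons, ofDigits, List.foldl_append]
    change Nat.bit b (ofDigits n.bits.reverse) = _
    rw [ih]

namespace PolyTime

@[fun_prop]
theorem ofDigits {l : γ → List Bool} (hl : PolyTime l) :
    PolyTime fun c => FairDivision.ofDigits (l c) :=
  foldl (s := fun _ => 0) (f := fun _ n b => Nat.bit b n) hl (const _) (by fun_prop)
    (fun c => 4 * sz (l c) + 1) (((PolyBdd.const 4).mul hl.polyBdd).add (.const 1))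
    (fun c l' hl' => by
      have h₁ := sz_nat_le_of_lt (ofDigits_lt l')
      have h₂ := length_lt_sz l'
      have h₃ := sz_prefix_le hl'
      change sz (FairDivision.ofDigits l') ≤ _
      omega)

end PolyTime

/-- One step of the addition of binary numbers, on the carry, the remaining summands and the digits
of the sum computed so far. -/
def addStep (s : Bool × ℕ × ℕ × List Bool) : Bool × ℕ × ℕ × List Bool :=
  ((s.2.1.bodd && s.2.2.1.bodd) || (s.1 && (s.2.1.bodd || s.2.2.1.bodd)), s.2.1.div2, s.2.2.1.div2,
    ((s.2.1.bodd == s.2.2.1.bodd) == s.1) :: s.2.2.2)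

theorem bodd_add_div2' (n : ℕ) : n.bodd.toNat + 2 * n.div2 = n := by
  have := Nat.bodd_add_div2 n
  simpa using this

/-- The invariant of a full adder: the emitted digit plus twice what remains, carry included, equals
what was there before. -/
theorem addStep_spec (s : Bool × ℕ × ℕ × List Bool) :
    2 * ((addStep s).1.toNat + (addStep s).2.1 + (addStep s).2.2.1)
      + ((s.2.1.bodd == s.2.2.1.bodd) == s.1).toNat = s.1.toNat + s.2.1 + s.2.2.1 := by
  have h₁ := bodd_add_div2' s.2.1
  have h₂ := bodd_add_div2' s.2.2.1
  simp only [addStep]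
  cases s.1 <;> cases hx : s.2.1.bodd <;> cases hy : s.2.2.1.bodd <;> simp [hx, hy] at h₁ h₂ ⊢ <;>
    omega

/-- Digits are emitted from the least significant one and consed, so the result is already in the
order that `ofDigits` reads. The length hypothesis guarantees enough rounds to exhaust both summands
and the carry; surplus rounds only add leading zeros. -/
theorem foldl_addStep {α : Type} (l : List α) (s : Bool × ℕ × ℕ × List Bool)
    (h : s.1.toNat + s.2.1 + s.2.2.1 < 2 ^ l.length) :
    ofDigits (l.foldl (fun s _ => addStep s) s).2.2.2
      = (s.1.toNat + s.2.1 + s.2.2.1) * 2 ^ s.2.2.2.length + ofDigits s.2.2.2 := by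
  induction l generalizing s with
  | nil =>
    have : s.1.toNat + s.2.1 + s.2.2.1 = 0 := by simpa using h
    simp [this]
  | cons a l ih =>
    have hs := addStep_spec s
    rw [List.foldl_cons, ih _ (by rw [List.length_cons, pow_succ] at h; omega), ← hs]
    simp only [addStep, ofDigits_cons, List.length_cons, pow_succ]
    ring

theorem foldl_addStep_bounds {α : Type} (l : List α) (s : Bool × ℕ × ℕ × List Bool) :
    (l.foldl (fun s _ => addStep s) s).2.1 ≤ s.2.1 ∧
    (l.foldl (fun s _ => addStep s) s).2.2.1 ≤ s.2.2.1 ∧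
    (l.foldl (fun s _ => addStep s) s).2.2.2.length = s.2.2.2.length + l.length := by
  induction l generalizing s with
  | nil => simp
  | cons a l ih =>
    obtain ⟨h₁, h₂, h₃⟩ := ih (addStep s)
    have h₄ := bodd_add_div2' s.2.1
    have h₅ := bodd_add_div2' s.2.2.1
    rw [List.foldl_cons]
    refine ⟨h₁.trans ?_, h₂.trans ?_, h₃.trans ?_⟩
    · simp only [addStep]; omega
    · simp only [addStep]; omega
    · simp only [addStep, List.length_cons]; omega

/-- A list that is longer than the binary expansion of `m + n`. -/
def counter (m n : ℕ) : List Bool := true :: (m.bits ++ n.bits)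

theorem add_lt_two_pow_counter (m n : ℕ) : m + n < 2 ^ (counter m n).length := by
  have h₁ := Nat.lt_size_self m
  have h₂ := Nat.lt_size_self n
  have h₃ : 2 ^ m.size ≤ 2 ^ (m.size + n.size) := Nat.pow_le_pow_right (by simp) (by simp)
  have h₄ : 2 ^ n.size ≤ 2 ^ (m.size + n.size) := Nat.pow_le_pow_right (by simp) (by simp)
  simp only [counter, List.length_cons, List.length_append, Nat.size_eq_bits_len, pow_succ]
  omega

/-- One step of the comparison of binary numbers. -/
def leStep (s : Bool × ℕ × ℕ) : Bool × ℕ × ℕ :=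
  (bif s.2.1.bodd == s.2.2.bodd then s.1 else s.2.2.bodd, s.2.1.div2, s.2.2.div2)

/-- Digits are compared from the least significant one upwards, so a later difference overrides the
verdict so far and equal digits keep it. -/
theorem foldl_leStep {α : Type} (l : List α) (s : Bool × ℕ × ℕ)
    (h : s.2.1 + s.2.2 < 2 ^ l.length) :
    (l.foldl (fun s _ => leStep s) s).1 = true ↔ s.2.1 < s.2.2 ∨ s.2.1 = s.2.2 ∧ s.1 = true := by
  induction l generalizing s with
  | nil =>
    simp at h
    simp [h]
  | cons a l ih =>
    have h₁ := bodd_add_div2' s.2.1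
    have h₂ := bodd_add_div2' s.2.2
    rw [List.foldl_cons, ih _ (by rw [List.length_cons, pow_succ] at h; simp only [leStep]; omega)]
    simp only [leStep]
    cases hx : s.2.1.bodd <;> cases hy : s.2.2.bodd <;> simp [hx, hy] at h₁ h₂ ⊢ <;>
      grind

theorem foldl_leStep_bounds {α : Type} (l : List α) (s : Bool × ℕ × ℕ) :
    (l.foldl (fun s _ => leStep s) s).2.1 ≤ s.2.1 ∧
    (l.foldl (fun s _ => leStep s) s).2.2 ≤ s.2.2 := by
  induction l generalizing s with
  | nil => simp
  | cons a l ih =>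
    obtain ⟨h₁, h₂⟩ := ih (leStep s)
    have h₄ := bodd_add_div2' s.2.1
    have h₅ := bodd_add_div2' s.2.2
    rw [List.foldl_cons]
    refine ⟨h₁.trans ?_, h₂.trans ?_⟩
    · simp only [leStep]; omega
    · simp only [leStep]; omega

namespace PolyTime

@[fun_prop]
theorem counter {f g : γ → ℕ} (hf : PolyTime f) (hg : PolyTime g) :
    PolyTime fun c => FairDivision.counter (f c) (g c) := by
  unfold FairDivision.counter
  fun_prop

@[fun_prop]
theorem add {f g : γ → ℕ} (hf : PolyTime f) (hg : PolyTime g) : PolyTime fun c => f c + g c := by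
  have hc := hf.counter hg
  have := foldl (s := fun c => (false, f c, g c, [])) (f := fun _ s _ => addStep s) hc
    (by fun_prop) (by unfold addStep; fun_prop)
    (fun c => 4 * sz (f c) + 4 * sz (g c) + 4 * sz (FairDivision.counter (f c) (g c)) + 20)
    (((((PolyBdd.const 4).mul hf.polyBdd).add ((PolyBdd.const 4).mul hg.polyBdd)).add
      ((PolyBdd.const 4).mul hc.polyBdd)).add (.const 20)) (by
      intro c l' hl'
      have hb := foldl_addStep_bounds l' (false, f c, g c, [])
      generalize l'.foldl (fun s _ => addStep s) (false, f c, g c, []) = s at hb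
      obtain ⟨b, m, n, l⟩ := s
      obtain ⟨h₁, h₂, h₃⟩ := hb
      have := sz_nat_le_of_le h₁
      have := sz_nat_le_of_le h₂
      have := sz_bits_le l
      have := sz_prefix_le hl'
      have := length_lt_sz l'
      have := sz_bool_le b
      simp only [sz_mk, List.length_nil] at *
      omega)
  refine of_enc_eq (ofDigits (snd (snd (snd this)))) fun c => congrArg enc ?_
  rw [foldl_addStep _ _ (by simpa using add_lt_two_pow_counter (f c) (g c))]
  simp [FairDivision.ofDigits]

@[fun_prop]
theorem le {f g : γ → ℕ} (hf : PolyTime f) (hg : PolyTime g) :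
    PolyTime fun c => decide (f c ≤ g c) := by
  have hc := hf.counter hg
  have := foldl (s := fun c => (true, f c, g c)) (f := fun _ s _ => leStep s) hc
    (by fun_prop) (by unfold leStep; fun_prop)
    (fun c => 4 * sz (f c) + 4 * sz (g c) + 20)
    ((((PolyBdd.const 4).mul hf.polyBdd).add ((PolyBdd.const 4).mul hg.polyBdd)).add (.const 20))
    (by
      intro c l' hl'
      have hb := foldl_leStep_bounds l' (true, f c, g c)
      generalize l'.foldl (fun s _ => leStep s) (true, f c, g c) = s at hb
      obtain ⟨b, m, n⟩ := s
      obtain ⟨h₁, h₂⟩ := hb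
      have := sz_nat_le_of_le h₁
      have := sz_nat_le_of_le h₂
      have := sz_bool_le b
      simp only [sz_mk] at *
      omega)
  refine of_enc_eq (fst this) fun c => congrArg enc ?_
  rw [Bool.eq_iff_iff, foldl_leStep _ _ (add_lt_two_pow_counter (f c) (g c))]
  simp
  omega

@[fun_prop]
theorem eq_nat {f g : γ → ℕ} (hf : PolyTime f) (hg : PolyTime g) :
    PolyTime fun c => decide (f c = g c) :=
  of_enc_eq ((hf.le hg).and (hg.le hf)) fun c => congrArg enc (by
    rw [Bool.eq_iff_iff]
    simp
    omega)

@[fun_prop]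
theorem mul {f g : γ → ℕ} (hf : PolyTime f) (hg : PolyTime g) : PolyTime fun c => f c * g c := by
  -- Horner's scheme: with the most significant digit first, double and then add `n` for each digit
  -- one.
  have key (l : List Bool) (n : ℕ) :
      l.foldl (fun s b => Nat.bit false s + bif b then n else 0) 0 = FairDivision.ofDigits l * n := by
    induction l using List.reverseRecOn with
    | nil => simp [FairDivision.ofDigits]
    | append_singleton l b ih =>
      simp only [FairDivision.ofDigits] at ih ⊢
      rw [List.foldl_append, ih, List.foldl_append]
      cases b <;> simp [Nat.bit] <;> ring
  have := foldl (l := fun c => (f c).bits.reverse) (s := fun _ => 0)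
    (f := fun c s b => Nat.bit false s + bif b then g c else 0)
    (by fun_prop) (const _) (by fun_prop)
    (fun c => 4 * (sz (f c) + sz (g c)) + 1)
    (((PolyBdd.const 4).mul (hf.polyBdd.add hg.polyBdd)).add (.const 1)) (by
      intro c l' hl'
      rw [key]
      have h₁ : FairDivision.ofDigits l' * g c < 2 ^ (l'.length + (g c).size) := by
        rw [pow_add]
        exact Nat.mul_lt_mul'' (ofDigits_lt l') (Nat.lt_size_self _)
      have := sz_nat_le_of_lt h₁
      have := length_lt_sz l'
      have := sz_prefix_le hl'
      have := size_lt_sz (g c)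
      have : sz (f c).bits.reverse = sz (f c) := sz_reverse _
      omega)
  refine of_enc_eq this fun c => congrArg enc ?_
  rw [key, ofDigits_reverse_bits]

end PolyTime
end FairDivision
end

noncomputable section
namespace FairDivision
open Computability (Γ')
open Enc (enc)
variable {γ : Type} [Enc γ]

/-! ### The greedy algorithm on lists of fractions -/

/-- Comparison of fractions, given by numerator and denominator. -/
def fracLe (x y : ℕ × ℕ) : Bool := decide (x.1 * y.2 ≤ y.1 * x.2)

/-- The sum of two fractions. -/
def fracAdd (x y : ℕ × ℕ) : ℕ × ℕ := (x.1 * y.2 + y.1 * x.2, x.2 * y.2)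

/-- The sum of a list of fractions. -/
def fracSum (l : List (ℕ × ℕ)) : ℕ × ℕ := l.foldl fracAdd (0, 1)

/-- Split a list with head `x` into a greatest fraction and the other ones. -/
def pickMax (x : ℕ × ℕ) (l : List (ℕ × ℕ)) : (ℕ × ℕ) × List (ℕ × ℕ) :=
  l.foldl (fun s y => bif fracLe s.1 y then (y, s.1 :: s.2) else (s.1, y :: s.2)) (x, [])

/-- Split a list with head `x` into a least fraction and the other ones. -/
def pickMin (x : ℕ × ℕ) (l : List (ℕ × ℕ)) : (ℕ × ℕ) × List (ℕ × ℕ) :=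
  l.foldl (fun s y => bif fracLe y s.1 then (y, s.1 :: s.2) else (s.1, y :: s.2)) (x, [])

/-- Whether an agent with goods `l` is EF1 towards an agent with goods `l'`. -/
def ef1Towards (l l' : List (ℕ × ℕ)) : Bool :=
  l'.isEmpty || fracLe (fracSum (pickMax (l'.headD (0, 1)) l'.tail).2) (fracSum l)

/-- Whether a pair of bundles is EF1. -/
def ef1 (p : List (ℕ × ℕ) × List (ℕ × ℕ)) : Bool := ef1Towards p.1 p.2 && ef1Towards p.2 p.1

/-- Exchange a least good of the first bundle and a most valuable good of the second one. -/
def swapExtremes (l l' : List (ℕ × ℕ)) : List (ℕ × ℕ) × List (ℕ × ℕ) :=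
  bif l.isEmpty || l'.isEmpty then (l, l') else
    ((pickMax (l'.headD (0, 1)) l'.tail).1 :: (pickMin (l.headD (0, 1)) l.tail).2,
      (pickMin (l.headD (0, 1)) l.tail).1 :: (pickMax (l'.headD (0, 1)) l'.tail).2)

/-- A greedy exchange. -/
def greedySwap (p : List (ℕ × ℕ) × List (ℕ × ℕ)) : List (ℕ × ℕ) × List (ℕ × ℕ) :=
  bif fracLe (fracSum p.1) (fracSum p.2) then swapExtremes p.1 p.2
  else ((swapExtremes p.2 p.1).2, (swapExtremes p.2 p.1).1)

/-- One round of the greedy algorithm, which counts the exchanges. -/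
def greedyRound (s : ℕ × List (ℕ × ℕ) × List (ℕ × ℕ)) : ℕ × List (ℕ × ℕ) × List (ℕ × ℕ) :=
  bif ef1 s.2 then s else (s.1 + 1, greedySwap s.2)

/-- Whether the greedy algorithm needs at most `k` exchanges. -/
def greedyAnswer (k : ℕ) (l l' : List (ℕ × ℕ)) : Bool :=
  ef1 ((l ++ l').foldl (fun s _ => greedyRound s) (0, l, l')).2 &&
    decide (((l ++ l').foldl (fun s _ => greedyRound s) (0, l, l')).1 ≤ k)

/-- Without any reduction to lowest terms, the bit lengths of numerator and denominator are at most
the size of the list, because products add bit lengths. -/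
theorem fracSum_lt (l : List (ℕ × ℕ)) : (fracSum l).1 < 2 ^ sz l ∧ (fracSum l).2 < 2 ^ sz l := by
  induction l using List.reverseRecOn with
  | nil => simp [fracSum]
  | append_singleton l x ih =>
    have h : sz (l ++ [x]) = sz l + (sz x.1 + sz x.2 + 2) := by
      have := sz_append l [x]
      simp only [sz_cons, sz_nil] at this
      have hx : sz x = sz x.1 + sz x.2 + 1 := rfl
      omega
    have e : fracSum (l ++ [x]) = fracAdd (fracSum l) x := by simp [fracSum]
    have h₁ : x.1 < 2 ^ sz x.1 := Nat.size_le.1 (size_lt_sz _).le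
    have h₂ : x.2 < 2 ^ sz x.2 := Nat.size_le.1 (size_lt_sz _).le
    have h₃ : 2 ^ sz x.1 ≤ 2 ^ (sz x.1 + sz x.2) := Nat.pow_le_pow_right (by simp) (by simp)
    have h₄ : 2 ^ sz x.2 ≤ 2 ^ (sz x.1 + sz x.2) := Nat.pow_le_pow_right (by simp) (by simp)
    have k₁ := Nat.mul_le_mul ih.1.le (h₂.le.trans h₄)
    have k₂ := Nat.mul_le_mul (h₁.le.trans h₃) ih.2.le
    have k₃ := Nat.mul_le_mul ih.2.le (h₂.le.trans h₄)
    -- Appending a fraction costs two constructor nodes beyond its two numbers; the resulting factor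
    -- 4 absorbs the sum of the two cross products.
    have e' : 2 ^ (sz l + (sz x.1 + sz x.2 + 2)) = 4 * (2 ^ sz l * 2 ^ (sz x.1 + sz x.2)) := by
      rw [pow_add, pow_add _ _ 2]; ring
    have k₄ : 0 < 2 ^ sz l * 2 ^ (sz x.1 + sz x.2) := by positivity
    rw [h, e, fracAdd, e']
    rw [mul_comm (2 ^ (sz x.1 + sz x.2))] at k₂
    exact ⟨by dsimp only; omega, by dsimp only; omega⟩

theorem pickMax_perm (x : ℕ × ℕ) (l : List (ℕ × ℕ)) :
    ((pickMax x l).1 :: (pickMax x l).2).Perm (x :: l) := by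
  induction l using List.reverseRecOn with
  | nil => simp [pickMax]
  | append_singleton l y ih =>
    simp only [pickMax] at ih ⊢
    rw [List.foldl_append, List.foldl_cons, List.foldl_nil]
    have h : (x :: (l ++ [y])).Perm (y :: x :: l) := by
      rw [← List.cons_append]; exact List.perm_append_singleton _ _
    cases fracLe (List.foldl _ (x, []) l).1 y
    · exact (List.Perm.swap _ _ _).trans ((ih.cons y).trans h.symm)
    · exact (ih.cons y).trans h.symm

theorem pickMin_perm (x : ℕ × ℕ) (l : List (ℕ × ℕ)) :
    ((pickMin x l).1 :: (pickMin x l).2).Perm (x :: l) := by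
  induction l using List.reverseRecOn with
  | nil => simp [pickMin]
  | append_singleton l y ih =>
    simp only [pickMin] at ih ⊢
    rw [List.foldl_append, List.foldl_cons, List.foldl_nil]
    have h : (x :: (l ++ [y])).Perm (y :: x :: l) := by
      rw [← List.cons_append]; exact List.perm_append_singleton _ _
    cases fracLe y (List.foldl _ (x, []) l).1
    · exact (List.Perm.swap _ _ _).trans ((ih.cons y).trans h.symm)
    · exact (ih.cons y).trans h.symm

theorem sz_perm {α : Type} [Enc α] {l l' : List α} (h : l.Perm l') : sz l = sz l' := by
  induction h with
  | nil => rfl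
  | cons a _ ih => simp [ih]
  | swap a b l => simp; omega
  | trans _ _ ih₁ ih₂ => exact ih₁.trans ih₂

theorem swapExtremes_perm (l l' : List (ℕ × ℕ)) :
    ((swapExtremes l l').1 ++ (swapExtremes l l').2).Perm (l ++ l') := by
  obtain _ | ⟨x, l⟩ := l
  · simp [swapExtremes]
  obtain _ | ⟨y, l'⟩ := l'
  · simp [swapExtremes]
  have h₁ := pickMin_perm x l
  have h₂ := pickMax_perm y l'
  simp only [swapExtremes, List.isEmpty_cons, Bool.or_self, cond_false, List.headD_cons,
    List.tail_cons]
  generalize pickMin x l = p at *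
  generalize pickMax y l' = q at *
  refine List.Perm.trans ?_ (h₁.append h₂)
  rw [← Multiset.coe_eq_coe]
  simp only [← Multiset.coe_add, ← Multiset.cons_coe, ← Multiset.singleton_add]
  abel

theorem greedySwap_perm (p : List (ℕ × ℕ) × List (ℕ × ℕ)) :
    ((greedySwap p).1 ++ (greedySwap p).2).Perm (p.1 ++ p.2) := by
  unfold greedySwap
  cases fracLe (fracSum p.1) (fracSum p.2)
  · exact (List.perm_append_comm.trans (swapExtremes_perm p.2 p.1)).trans List.perm_append_comm
  · exact swapExtremes_perm p.1 p.2

/-- Rounds only permute the goods among the bundles, so the state does not grow apart from the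
counter. This is the size bound needed to iterate them in polynomial time. -/
theorem foldl_greedyRound_bounds {α : Type} (l : List α) (s : ℕ × List (ℕ × ℕ) × List (ℕ × ℕ)) :
    (l.foldl (fun s _ => greedyRound s) s).1 ≤ s.1 + l.length ∧
    ((l.foldl (fun s _ => greedyRound s) s).2.1 ++
      (l.foldl (fun s _ => greedyRound s) s).2.2).Perm (s.2.1 ++ s.2.2) := by
  induction l generalizing s with
  | nil => simp
  | cons a l ih =>
    rw [List.foldl_cons]
    have h := ih (greedyRound s)
    have h' : (greedyRound s).1 ≤ s.1 + 1 ∧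
        ((greedyRound s).2.1 ++ (greedyRound s).2.2).Perm (s.2.1 ++ s.2.2) := by
      unfold greedyRound
      cases ef1 s.2
      · exact ⟨le_rfl, greedySwap_perm _⟩
      · exact ⟨by simp, List.Perm.refl _⟩
    exact ⟨by rw [List.length_cons]; omega, h.2.trans h'.2⟩

namespace PolyTime

@[fun_prop]
theorem fracLe {f g : γ → ℕ × ℕ} (hf : PolyTime f) (hg : PolyTime g) :
    PolyTime fun c => FairDivision.fracLe (f c) (g c) := by
  unfold FairDivision.fracLe
  fun_prop

@[fun_prop]
theorem fracAdd {f g : γ → ℕ × ℕ} (hf : PolyTime f) (hg : PolyTime g) :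
    PolyTime fun c => FairDivision.fracAdd (f c) (g c) := by
  unfold FairDivision.fracAdd
  fun_prop

@[fun_prop]
theorem fracSum {l : γ → List (ℕ × ℕ)} (hl : PolyTime l) :
    PolyTime fun c => FairDivision.fracSum (l c) := by
  refine foldl (s := fun _ => (0, 1)) (f := fun _ => FairDivision.fracAdd) hl (const _)
    (by fun_prop) (fun c => 8 * sz (l c) + 3)
    (((PolyBdd.const 8).mul hl.polyBdd).add (.const 3)) fun c l' hl' => ?_
  have h := fracSum_lt l'
  have h₁ := sz_nat_le_of_lt h.1
  have h₂ := sz_nat_le_of_lt h.2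
  have h₃ := sz_prefix_le hl'
  change sz (FairDivision.fracSum l').1 + sz (FairDivision.fracSum l').2 + 1 ≤ _
  omega

@[fun_prop]
theorem pickMax {x : γ → ℕ × ℕ} {l : γ → List (ℕ × ℕ)} (hx : PolyTime x) (hl : PolyTime l) :
    PolyTime fun c => FairDivision.pickMax (x c) (l c) := by
  unfold FairDivision.pickMax
  refine foldl (s := fun c => (x c, [])) hl (by fun_prop) (f := fun _ s y =>
    bif FairDivision.fracLe s.1 y then (y, s.1 :: s.2) else (s.1, y :: s.2)) (by fun_prop)
    (fun c => sz (x c) + sz (l c) + 1) ((hx.polyBdd.add hl.polyBdd).add (.const 1))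
    fun c l' hl' => ?_
  have h₁ := sz_perm (pickMax_perm (x c) l')
  have h₂ := sz_prefix_le hl'
  simp only [sz_cons] at h₁
  change sz (FairDivision.pickMax (x c) l').1 + sz (FairDivision.pickMax (x c) l').2 + 1 ≤ _
  omega

@[fun_prop]
theorem pickMin {x : γ → ℕ × ℕ} {l : γ → List (ℕ × ℕ)} (hx : PolyTime x) (hl : PolyTime l) :
    PolyTime fun c => FairDivision.pickMin (x c) (l c) := by
  unfold FairDivision.pickMin
  refine foldl (s := fun c => (x c, [])) hl (by fun_prop) (f := fun _ s y =>
    bif FairDivision.fracLe y s.1 then (y, s.1 :: s.2) else (s.1, y :: s.2)) (by fun_prop)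
    (fun c => sz (x c) + sz (l c) + 1) ((hx.polyBdd.add hl.polyBdd).add (.const 1))
    fun c l' hl' => ?_
  have h₁ := sz_perm (pickMin_perm (x c) l')
  have h₂ := sz_prefix_le hl'
  simp only [sz_cons] at h₁
  change sz (FairDivision.pickMin (x c) l').1 + sz (FairDivision.pickMin (x c) l').2 + 1 ≤ _
  omega

@[fun_prop]
theorem ef1Towards {l l' : γ → List (ℕ × ℕ)} (hl : PolyTime l) (hl' : PolyTime l') :
    PolyTime fun c => FairDivision.ef1Towards (l c) (l' c) := by
  unfold FairDivision.ef1Towards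
  fun_prop

@[fun_prop]
theorem ef1 {p : γ → List (ℕ × ℕ) × List (ℕ × ℕ)} (hp : PolyTime p) :
    PolyTime fun c => FairDivision.ef1 (p c) := by
  unfold FairDivision.ef1
  fun_prop

@[fun_prop]
theorem swapExtremes {l l' : γ → List (ℕ × ℕ)} (hl : PolyTime l) (hl' : PolyTime l') :
    PolyTime fun c => FairDivision.swapExtremes (l c) (l' c) := by
  unfold FairDivision.swapExtremes
  fun_prop

@[fun_prop]
theorem greedySwap {p : γ → List (ℕ × ℕ) × List (ℕ × ℕ)} (hp : PolyTime p) :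
    PolyTime fun c => FairDivision.greedySwap (p c) := by
  unfold FairDivision.greedySwap
  fun_prop

@[fun_prop]
theorem greedyRound {p : γ → ℕ × List (ℕ × ℕ) × List (ℕ × ℕ)} (hp : PolyTime p) :
    PolyTime fun c => FairDivision.greedyRound (p c) := by
  unfold FairDivision.greedyRound
  fun_prop

@[fun_prop]
theorem greedyAnswer {k : γ → ℕ} {l l' : γ → List (ℕ × ℕ)} (hk : PolyTime k) (hl : PolyTime l)
    (hl' : PolyTime l') : PolyTime fun c => FairDivision.greedyAnswer (k c) (l c) (l' c) := by
  have h : PolyTime fun c => (l c ++ l' c).foldl (fun s _ => FairDivision.greedyRound s)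
      (0, l c, l' c) := by
    refine foldl (f := fun _ s _ => FairDivision.greedyRound s) (hl.append hl') (by fun_prop)
      (by fun_prop) (fun c => 5 * (sz (l c) + sz (l' c)) + 10)
      (((PolyBdd.const 5).mul (hl.polyBdd.add hl'.polyBdd)).add (.const 10)) fun c t ht => ?_
    obtain ⟨h₁, h₂⟩ := foldl_greedyRound_bounds t (0, l c, l' c)
    generalize t.foldl (fun s _ => FairDivision.greedyRound s) (0, l c, l' c) = s at *
    obtain ⟨n, a, b⟩ := s
    have h₃ := sz_perm h₂
    have h₄ := sz_append a b
    have h₅ := sz_append (l c) (l' c)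
    have h₆ := length_lt_sz t
    have h₇ := sz_prefix_le ht
    have h₈ := sz_nat_le_of_lt (Nat.lt_two_pow_self (n := n))
    simp only [sz_mk] at *
    omega
  unfold FairDivision.greedyAnswer
  fun_prop

end PolyTime
end FairDivision
end

noncomputable section
namespace FairDivision
open Computability (Γ')
open Enc (enc)
variable {γ : Type} [Enc γ]

/-! ### Parsing inputs -/

/-- The states of the parser: the phase, the digits of the number that is read (last digit first),
the bound `k`, the owner and the numerator of the good that is read, and the previous goods (last
good first). The phases are: `0` reading `k`, `1` expecting an owner, `2` reading a numerator,
`3` reading a denominator, `4` after a good, `5` failure. -/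
abbrev ParseState : Type := ℕ × List Bool × ℕ × Bool × ℕ × List (Bool × ℕ × ℕ)

/-- Whether a symbol is a digit. -/
def isBit (x : Γ') : Bool := decide (symIdx x = 1) || decide (symIdx x = 2)

/-- The value of a digit. -/
def bitOf (x : Γ') : Bool := decide (symIdx x = 2)

/-- Whether the digits of a number (most significant digit first) have no superfluous zeros. -/
def isCanon (l : List Bool) : Bool := l.isEmpty || l.headD false

/-- The failure state of the parser. -/
def parseFail : ParseState := (5, [], 0, false, 0, [])

/-- Parse one symbol. -/
def parseStep : ParseState → Γ' → ParseState := fun s x =>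
  bif decide (s.1 = 0) then
    bif isBit x then (0, bitOf x :: s.2.1, s.2.2)
    else bif decide (symIdx x = 3) && isCanon s.2.1 then
      (1, [], ofDigits s.2.1, s.2.2.2)
    else parseFail
  else bif decide (s.1 = 1) then
    bif isBit x then (2, [], s.2.2.1, bitOf x, 0, s.2.2.2.2.2) else parseFail
  else bif decide (s.1 = 2) then
    bif isBit x then (2, bitOf x :: s.2.1, s.2.2)
    else bif decide (symIdx x = 5) && isCanon s.2.1 then
      (3, [], s.2.2.1, s.2.2.2.1, ofDigits s.2.1, s.2.2.2.2.2)
    else parseFail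
  else bif decide (s.1 = 3) then
    bif isBit x then (3, bitOf x :: s.2.1, s.2.2)
    else bif decide (symIdx x = 4) && isCanon s.2.1 && !s.2.1.isEmpty then
      (4, [], s.2.2.1, false, 0, (s.2.2.2.1, s.2.2.2.2.1, ofDigits s.2.1) :: s.2.2.2.2.2)
    else parseFail
  else bif decide (s.1 = 4) && decide (symIdx x = 3) then
    (1, [], s.2.2.1, false, 0, s.2.2.2.2.2)
  else parseFail

/-- The initial state of the parser. -/
def parseInit : ParseState := (0, [], 0, false, 0, [])

/-- Parse a word. -/
def parse (w : List Γ') : ParseState := w.foldl parseStep parseInit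

/-- The utilities of the goods of one agent. -/
def goodsOf (b : Bool) (l : List (Bool × ℕ × ℕ)) : List (ℕ × ℕ) :=
  l.foldl (fun s g => bif g.1 == b then g.2 :: s else s) []

/-- The decision procedure. -/
def decideWord (w : List Γ') : Bool :=
  decide ((parse w).1 = 4) && greedyAnswer (parse w).2.2.1
    (goodsOf false (parse w).2.2.2.2.2) (goodsOf true (parse w).2.2.2.2.2)

/-- A potential argument: the weighted size of the state grows by at most 10 per symbol. Pending
digits have weight 4, which prepays for their conversion into a number by `ofDigits`. -/
theorem sz_foldl_parseStep (w : List Γ') :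
    sz (w.foldl parseStep parseInit) ≤ 10 * w.length + 60 := by
  have step (s : ParseState) (x : Γ') : 4 * (parseStep s x).2.1.length + sz (parseStep s x).2.2.1 +
      sz (parseStep s x).2.2.2.2.1 + sz (parseStep s x).2.2.2.2.2 ≤
      4 * s.2.1.length + sz s.2.2.1 + sz s.2.2.2.2.1 + sz s.2.2.2.2.2 + 10 ∧
      (parseStep s x).1 ≤ 5 := by
    obtain ⟨p, l, k, o, n, g⟩ := s
    have h₁ := sz_nat_le_of_lt (ofDigits_lt l)
    have h₂ := one_le_sz k
    have h₃ := one_le_sz n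
    have h₄ := one_le_sz g
    have h₅ := sz_bool_le o
    have h₀ : sz (0 : ℕ) = 1 := rfl
    simp only [parseStep, Bool.cond_eq_ite]
    split_ifs <;> simp only [parseFail, List.length_cons, List.length_nil, sz_nil, sz_cons, sz_mk,
      h₀] <;> omega
  have bound (w : List Γ') (s : ParseState) (hs : s.1 ≤ 5) :
      4 * (w.foldl parseStep s).2.1.length + sz (w.foldl parseStep s).2.2.1 +
      sz (w.foldl parseStep s).2.2.2.2.1 + sz (w.foldl parseStep s).2.2.2.2.2 ≤
      4 * s.2.1.length + sz s.2.2.1 + sz s.2.2.2.2.1 + sz s.2.2.2.2.2 + 10 * w.length ∧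
      (w.foldl parseStep s).1 ≤ 5 := by
    induction w generalizing s with
    | nil => simpa using hs
    | cons x w ih =>
      have h₁ := step s x
      have h₂ := ih _ h₁.2
      rw [List.foldl_cons, List.length_cons]
      omega
  have h := bound w parseInit (by decide)
  generalize w.foldl parseStep parseInit = s at *
  obtain ⟨p, l, k, o, n, g⟩ := s
  have h₁ : sz p ≤ 13 := sz_nat_le_of_lt (k := 3) (by have := h.2; simp only at this; omega)
  have h₂ := sz_bits_le l
  have h₃ := sz_bool_le o
  have h₀ : sz (0 : ℕ) = 1 := rfl
  simp only [parseInit, sz_nil, List.length_nil, sz_mk, h₀] at h ⊢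
  omega

/-! ### The decision procedure runs in polynomial time -/

namespace PolyTime

@[fun_prop]
theorem symIdx {f : γ → Γ'} (hf : PolyTime f) : PolyTime fun c => FairDivision.symIdx (f c) :=
  of_enc_eq hf fun _ => rfl

@[fun_prop]
theorem parseStep {s : γ → ParseState} {x : γ → Γ'} (hs : PolyTime s) (hx : PolyTime x) :
    PolyTime fun c => FairDivision.parseStep (s c) (x c) := by
  unfold FairDivision.parseStep isBit bitOf isCanon
  fun_prop

@[fun_prop]
theorem parse {w : γ → List Γ'} (hw : PolyTime w) :
    PolyTime fun c => FairDivision.parse (w c) := by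
  unfold FairDivision.parse
  refine foldl (s := fun _ => parseInit) (f := fun _ => FairDivision.parseStep) hw (const _)
    (by fun_prop) (fun c => 10 * sz (w c) + 60)
    (((PolyBdd.const 10).mul hw.polyBdd).add (.const 60)) fun c l' hl' => ?_
  have h₁ := sz_foldl_parseStep l'
  have h₂ := length_lt_sz l'
  have h₃ := sz_prefix_le hl'
  omega

@[fun_prop]
theorem goodsOf (b : Bool) {l : γ → List (Bool × ℕ × ℕ)} (hl : PolyTime l) :
    PolyTime fun c => FairDivision.goodsOf b (l c) := by
  unfold FairDivision.goodsOf
  refine foldl (s := fun _ => []) (f := fun _ s g => bif g.1 == b then g.2 :: s else s) hl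
    (const _) (by fun_prop) (fun c => sz (l c)) hl.polyBdd fun c l' hl' => ?_
  refine le_trans ?_ (sz_prefix_le hl')
  have key (l : List (Bool × ℕ × ℕ)) (t : List (ℕ × ℕ)) :
      sz (l.foldl (fun s g => bif g.1 == b then g.2 :: s else s) t) + 1 ≤ sz t + sz l := by
    induction l generalizing t with
    | nil => simp
    | cons x l ih =>
      rw [List.foldl_cons]
      refine (ih _).trans ?_
      have : sz x = sz x.1 + sz x.2 + 1 := rfl
      cases x.1 == b
      · simp; omega
      · simp; omega
  have := key l' []
  rw [sz_nil] at this
  omega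

theorem decideWord : PolyTime FairDivision.decideWord := by
  unfold FairDivision.decideWord
  fun_prop

end PolyTime

theorem wordVal_eq (w : List Γ') : wordVal w = enc w := by
  have key (l : List Bool) : bitsVal l = enc l := by
    induction l with
    | nil => rfl
    | cons b l ih => cases b <;> (simp only [bitsVal, ih]; rfl)
  induction w with
  | nil => rfl
  | cons s w ih => rw [wordVal, ih, symVal, key]; rfl

theorem sz_word_le (w : List Γ') : sz w ≤ 14 * w.length + 1 := by
  induction w with
  | nil => simp
  | cons s w ih =>
    -- Symbol indices are below `2 ^ 3`, and each binary digit accounts for at most 4 nodes.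
    have h : sz s ≤ 13 := sz_nat_le_of_lt (n := symIdx s) (k := 3)
      (by rcases s with _ | (_ | _) | _ | _ | _ <;> simp [symIdx])
    simp only [sz_cons, List.length_cons]
    omega

/-- A language that is decided by a polynomial-time function is in P. -/
theorem inP_of_polyTime {L : Language Γ'} {f : List Γ' → Bool} (hf : PolyTime f)
    (h : ∀ w, f w = true ↔ w ∈ L) : InP L := by
  -- The machine hands the reversed word to its program, so the program starts by reversing it back.
  have : PolyTime fun w : List Γ' => f w.reverse := by fun_prop
  obtain ⟨c, hc, p, hp⟩ := this
  refine inP_of_code c f h (fun w => ?_) (p.comp (14 * Polynomial.X + 1)) fun w => ?_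
  · rw [wordVal_eq, hc]
    simp only [List.reverse_reverse]
    rfl
  · rw [wordVal_eq]
    refine (hp _).trans ?_
    rw [Polynomial.eval_comp]
    refine eval_mono p ?_
    rw [sz_reverse]
    simpa using sz_word_le w

end FairDivision
end

noncomputable section
namespace FairDivision
open Computability (Γ')

/-! ### Optimality of greedy exchanges -/

section Greedy

variable {M : Type*} [Fintype M] [DecidableEq M]

@[simp] theorem mem_bundle {N : Type*} [DecidableEq N] {A : Allocation N M} {i : N} {g : M} :
    g ∈ bundle A i ↔ A g = i := by simp [bundle]

/-- The number of goods of agent `j` in `A` that belong to the other agent in `C`. -/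
def moved (j : Bool) (A C : Allocation Bool M) : ℕ := (bundle A j \ bundle C j).card

/-- With only two agents an exchange is precomposition with a transposition, which makes bundle
sizes and ownership easy to track. -/
theorem ExchangeOf.eq_swap {A B : Allocation Bool M} {i j : Bool} {g g' : M}
    (h : ExchangeOf A B i j g g') : B = A ∘ Equiv.swap g g' := by
  obtain ⟨hij, hg, hg', hi, hj, -⟩ := h
  rw [mem_bundle] at hg hg'
  have hne : g ≠ g' := fun h => hij (by rw [← hg, ← hg', h])
  have two : ∀ b : Bool, b = i ∨ b = j := by cases i <;> cases j <;> simp_all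
  funext x
  have hi := Finset.ext_iff.1 hi x
  have hj := Finset.ext_iff.1 hj x
  simp only [mem_bundle, Finset.mem_sdiff, Finset.mem_union, Finset.mem_singleton] at hi hj
  simp only [Function.comp_apply]
  by_cases h₁ : x = g
  · subst h₁
    rw [Equiv.swap_apply_left, hg', hj]
    exact ⟨.inr rfl, hne⟩
  · by_cases h₂ : x = g'
    · subst h₂
      rw [Equiv.swap_apply_right, hg, hi]
      exact ⟨.inr rfl, h₁⟩
    · rw [Equiv.swap_apply_of_ne_of_ne h₁ h₂]
      rcases two (A x) with h | h
      · rw [h, hi]; exact ⟨.inl h, h₁⟩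
      · rw [h, hj]; exact ⟨.inl h, h₂⟩

theorem exchangeOf_swap {A : Allocation Bool M} {i j : Bool} {g g' : M} (hij : i ≠ j)
    (hg : A g = i) (hg' : A g' = j) : ExchangeOf A (A ∘ Equiv.swap g g') i j g g' := by
  have hne : g ≠ g' := fun h => hij (by rw [← hg, ← hg', h])
  refine ⟨hij, by simpa, by simpa, ?_, ?_, fun l hi hj => ?_⟩
  · ext x
    simp only [mem_bundle, Finset.mem_sdiff, Finset.mem_union, Finset.mem_singleton,
      Function.comp_apply]
    by_cases h₁ : x = g
    · subst h₁; simp [hg', hij.symm]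
    · by_cases h₂ : x = g'
      · subst h₂; simp [hg, h₁]
      · simp [Equiv.swap_apply_of_ne_of_ne h₁ h₂, h₁, h₂]
  · ext x
    simp only [mem_bundle, Finset.mem_sdiff, Finset.mem_union, Finset.mem_singleton,
      Function.comp_apply]
    by_cases h₁ : x = g
    · subst h₁; simp [hg', hne]
    · by_cases h₂ : x = g'
      · subst h₂; simp [hg, hij]
      · simp [Equiv.swap_apply_of_ne_of_ne h₁ h₂, h₁, h₂]
  · cases i <;> cases j <;> cases l <;> simp_all

theorem card_bundle_comp (A : Allocation Bool M) (e : Equiv.Perm M) (i : Bool) :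
    (bundle (A ∘ e) i).card = (bundle A i).card := by
  refine Finset.card_bij (fun x _ => e x) (by simp) (fun x _ y _ h => e.injective h)
    fun y hy => ⟨e.symm y, by simpa using hy, by simp⟩

theorem Exchange.card_eq {A B : Allocation Bool M} (h : Exchange A B) (i : Bool) :
    (bundle B i).card = (bundle A i).card := by
  obtain ⟨i', j', g, g', h⟩ := h
  rw [h.eq_swap, card_bundle_comp]

theorem Exchange.card_sdiff_le {A B : Allocation Bool M} (h : Exchange A B) (j : Bool) :
    moved j A B ≤ 1 := by
  obtain ⟨i', j', g, g', h⟩ := h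
  have := h.eq_swap
  obtain ⟨hij, hg, hg', hi, hj, -⟩ := h
  rw [mem_bundle] at hg hg'
  refine Finset.card_le_one.2 fun x hx y hy => ?_
  have key : ∀ z ∈ bundle A j \ bundle B j, z = if j = i' then g else g' := by
    intro z hz
    rw [this] at hz
    simp only [Finset.mem_sdiff, mem_bundle, Function.comp_apply] at hz
    by_cases h₁ : z = g
    · subst h₁
      rw [if_pos (hz.1.symm.trans hg)]
    · by_cases h₂ : z = g'
      · subst h₂
        rw [if_neg (fun h => hij (by rw [← hg', hz.1, h]))]
      · rw [Equiv.swap_apply_of_ne_of_ne h₁ h₂] at hz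
        exact absurd hz.1 hz.2
  rw [key x hx, key y hy]

theorem moved_triangle (j : Bool) (A B C : Allocation Bool M) :
    moved j A C ≤ moved j A B + moved j B C := by
  refine (Finset.card_le_card fun x hx => ?_).trans (Finset.card_union_le _ _)
  simp only [Finset.mem_sdiff, Finset.mem_union, mem_bundle] at hx ⊢
  tauto

theorem ReachedIn.card_eq {T : ℕ} {A B : Allocation Bool M} (h : ReachedIn T A B) (i : Bool) :
    (bundle B i).card = (bundle A i).card := by
  obtain ⟨s, rfl, rfl, h⟩ := h
  induction T with
  | zero => rfl
  | succ T ih => rw [(h T (by omega)).card_eq, ih fun t ht => h t (by omega)]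

theorem ReachedIn.moved_le {T : ℕ} {A B : Allocation Bool M} (h : ReachedIn T A B) (j : Bool) :
    moved j A B ≤ T := by
  obtain ⟨s, rfl, rfl, h⟩ := h
  induction T with
  | zero => simp [moved]
  | succ T ih =>
    have h₁ := moved_triangle j (s 0) (s T) (s (T + 1))
    have h₂ := ih fun t ht => h t (by omega)
    have h₃ := (h T (by omega)).card_sdiff_le j
    omega

variable {u : M → ℝ≥0}

theorem util_sdiff_add {S : Finset M} {g : M} (hg : g ∈ S) : util u (S \ {g}) + u g = util u S := by
  rw [util, util, Finset.sdiff_singleton_eq_erase, Finset.sum_erase_add _ _ hg]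

theorem util_lt_of_not_ef1Towards {A : Allocation Bool M} {i j : Bool}
    (h : ¬ EF1Towards (fun _ => u) A i j) : util u (bundle A i) < util u (bundle A j) := by
  by_contra! h'
  refine h ?_
  rcases (bundle A j).eq_empty_or_nonempty with h₀ | ⟨g, hg⟩
  · exact .inl h₀
  · exact .inr ⟨g, hg, (Finset.sum_le_sum_of_subset Finset.sdiff_subset).trans h'⟩

/-- A greedy exchange that makes `i` give a least good to `j` and take a most valuable one. -/
structure GreedyStep (u : M → ℝ≥0) (A B : Allocation Bool M) (i j : Bool) (g g' : M) : Prop where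
  ne : i ≠ j
  left : A g = i
  right : A g' = j
  eq_swap : B = A ∘ Equiv.swap g g'
  least : ∀ h, A h = i → u g ≤ u h
  greatest : ∀ h, A h = j → u h ≤ u g'

theorem GreedyExchange.exists_step {A B : Allocation Bool M} {i j : Bool} (hij : i ≠ j)
    (h : GreedyExchange u A B) (hlt : util u (bundle A i) < util u (bundle A j)) :
    ∃ g g', GreedyStep u A B i j g g' := by
  obtain ⟨i', j', g, g', h, hlt', hl, hg⟩ := h
  obtain ⟨rfl, rfl⟩ : i' = i ∧ j' = j := by
    have := h.1
    have : ¬ (i' = j ∧ j' = i) := by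
      rintro ⟨rfl, rfl⟩
      exact lt_asymm hlt hlt'
    cases i <;> cases j <;> cases i' <;> cases j' <;> simp_all
  exact ⟨g, g', hij, by simpa using h.2.1, by simpa using h.2.2.1, h.eq_swap,
    by simpa using hl, by simpa using hg⟩

namespace GreedyStep

variable {A B : Allocation Bool M} {i j : Bool} {g g' : M}

/-- Without `g'`, the new bundle of `i` lies in her old one, which is worth less than the old bundle
of `j` without `g'`; and the latter lies in the new bundle of `j`. So the roles of `i` and `j`
cannot be reversed. -/
theorem ef1Towards (h : GreedyStep u A B i j g g') (hA : ¬ EF1Towards (fun _ => u) A i j) :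
    EF1Towards (fun _ => u) B j i := by
  obtain ⟨-, -, -, hi, hj, -⟩ := exchangeOf_swap h.ne h.left h.right
  rw [← h.eq_swap] at hi hj
  have hne : g ≠ g' := fun e => h.ne (by rw [← h.left, ← h.right, e])
  refine .inr ⟨g', by simp [h.eq_swap, h.left], ?_⟩
  have h₁ : util u (bundle A i) < util u (bundle A j \ {g'}) := by
    by_contra! h'
    exact hA (.inr ⟨g', by simp [h.right], h'⟩)
  have h₂ : bundle B i \ {g'} ⊆ bundle A i := by
    rw [hi]
    intro x
    simp only [Finset.mem_sdiff, Finset.mem_union, Finset.mem_singleton]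
    tauto
  have h₃ : bundle A j \ {g'} ⊆ bundle B j := by
    rw [hj]
    intro x
    simp only [Finset.mem_sdiff, Finset.mem_union, Finset.mem_singleton]
    tauto
  exact ((Finset.sum_le_sum_of_subset h₂).trans h₁.le).trans (Finset.sum_le_sum_of_subset h₃)

/-- The exchange argument. Equal bundle sizes and `A ≠ C` provide a good `x` going from `j` to `i`
and a good `y` going from `i` to `j` on the way to `C`. Letting `g'` play the role of `x` and `g`
that of `y` gives a target no worse for `i` towards `j`, in which the greedy exchange is part of the
required movement. -/
theorem exists_closer (h : GreedyStep u A B i j g g') (hA : ¬ EF1Towards (fun _ => u) A i j)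
    {C : Allocation Bool M} (hC : EF1Towards (fun _ => u) C i j)
    (hcard : ∀ l, (bundle C l).card = (bundle A l).card) :
    ∃ C' : Allocation Bool M, EF1Towards (fun _ => u) C' i j ∧
      (∀ l, (bundle C' l).card = (bundle B l).card) ∧ moved j B C' + 1 ≤ moved j A C := by
  have two : ∀ b : Bool, b ≠ j → b = i := by have := h.ne; cases i <;> cases j <;> simp_all
  have hAC : A ≠ C := by rintro rfl; exact hA hC
  have hj : ∃ x, A x = j ∧ C x = i := by
    by_contra! h'
    have h₁ : bundle A j ⊆ bundle C j := fun x hx => by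
      rw [mem_bundle] at *
      by_contra h''
      exact h' x hx (two _ h'')
    have h₂ := Finset.eq_of_subset_of_card_le h₁ (hcard j).le
    refine hAC (funext fun x => ?_)
    have := Finset.ext_iff.1 h₂ x
    rw [mem_bundle, mem_bundle] at this
    by_cases hx : A x = j
    · rw [hx, this.1 hx]
    · rw [two _ hx, two _ (mt this.2 hx)]
  have hi : ∃ y, A y = i ∧ C y = j := by
    by_contra! h'
    have h₁ : bundle A i ⊆ bundle C i := fun x hx => by
      rw [mem_bundle] at *
      by_contra h''
      exact h' x hx (by by_contra h3; exact h'' (two _ h3))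
    have h₂ := Finset.eq_of_subset_of_card_le h₁ (hcard i).le
    obtain ⟨x, hx, hx'⟩ := hj
    have := Finset.ext_iff.1 h₂ x
    rw [mem_bundle, mem_bundle, hx, hx'] at this
    exact h.ne (this.2 rfl).symm
  -- If `C` already moves `g'`, take `x = g'`, so that nothing changes; otherwise both goods swapped
  -- by `e` have different owners in `C`. The same is done for `y` and `g` below.
  obtain ⟨x, hx, hx', hxg⟩ : ∃ x, A x = j ∧ C x = i ∧ (C g' = i → x = g') := by
    by_cases h₁ : C g' = i
    · exact ⟨g', h.right, h₁, fun _ => rfl⟩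
    · obtain ⟨x, h₂, h₃⟩ := hj
      exact ⟨x, h₂, h₃, fun h => absurd h h₁⟩
  obtain ⟨y, hy, hy', hyg⟩ : ∃ y, A y = i ∧ C y = j ∧ (C g = j → y = g) := by
    by_cases h₁ : C g = j
    · exact ⟨g, h.left, h₁, fun _ => rfl⟩
    · obtain ⟨x, h₂, h₃⟩ := hi
      exact ⟨x, h₂, h₃, fun h => absurd h h₁⟩
  have hne := h.ne
  have n₁ : g' ≠ g := fun e => hne (by rw [← h.left, ← h.right, e])
  have n₂ : g' ≠ y := fun e => hne (by rw [← hy, ← h.right, e])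
  have n₃ : x ≠ g := fun e => hne (by rw [← h.left, ← hx, e])
  have n₄ : x ≠ y := fun e => hne (by rw [← hy, ← hx, e])
  let e : Equiv.Perm M := (Equiv.swap g' x).trans (Equiv.swap g y)
  have e₁ : e g' = x := by simp [e, Equiv.swap_apply_of_ne_of_ne n₃ n₄]
  have e₂ : e x = g' := by simp [e, Equiv.swap_apply_of_ne_of_ne n₁ n₂]
  have e₃ : e g = y := by simp [e, Equiv.swap_apply_of_ne_of_ne n₁.symm n₃.symm]
  have e₄ : e y = g := by simp [e, Equiv.swap_apply_of_ne_of_ne n₂.symm n₄.symm]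
  have e₅ : ∀ z, z ≠ g' → z ≠ x → z ≠ g → z ≠ y → e z = z := fun z h₁ h₂ h₃ h₄ => by
    simp [e, Equiv.swap_apply_of_ne_of_ne h₁ h₂, Equiv.swap_apply_of_ne_of_ne h₃ h₄]
  have ee : ∀ z, e (e z) = z := by
    intro z
    by_cases h₁ : z = g'; · rw [h₁, e₁, e₂]
    by_cases h₂ : z = x; · rw [h₂, e₂, e₁]
    by_cases h₃ : z = g; · rw [h₃, e₃, e₄]
    by_cases h₄ : z = y; · rw [h₄, e₄, e₃]
    rw [e₅ z h₁ h₂ h₃ h₄, e₅ z h₁ h₂ h₃ h₄]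
  have Ae : ∀ z, A (e z) = A z := by
    intro z
    by_cases h₁ : z = g'; · rw [h₁, e₁, hx, h.right]
    by_cases h₂ : z = x; · rw [h₂, e₂, hx, h.right]
    by_cases h₃ : z = g; · rw [h₃, e₃, hy, h.left]
    by_cases h₄ : z = y; · rw [h₄, e₄, hy, h.left]
    rw [e₅ z h₁ h₂ h₃ h₄]
  -- For a good of `j` in `C`, the only possible changes replace `g'` by `x`, which also belongs to
  -- `j` in `A`, or `y` by the least good `g`.
  have dec : ∀ z, C z = j → u (e z) ≤ u z := by
    intro z hz
    by_cases h₁ : z = g'; · rw [h₁, e₁]; exact h.greatest x hx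
    by_cases h₂ : z = x; · exact absurd (hx'.symm.trans (h₂ ▸ hz)) hne
    by_cases h₃ : z = g
    · rw [h₃, e₃, hyg (h₃ ▸ hz)]
    by_cases h₄ : z = y; · rw [h₄, e₄]; exact h.least y hy
    rw [e₅ z h₁ h₂ h₃ h₄]
  have inc : ∀ z, C z = i → u z ≤ u (e z) := by
    intro z hz
    by_cases h₁ : z = g'; · rw [h₁, e₁, hxg (h₁ ▸ hz)]
    by_cases h₂ : z = x; · rw [h₂, e₂]; exact h.greatest x hx
    by_cases h₃ : z = g; · rw [h₃, e₃]; exact h.least y hy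
    by_cases h₄ : z = y; · exact absurd (hz.symm.trans (h₄ ▸ hy')) hne
    rw [e₅ z h₁ h₂ h₃ h₄]
  have hB : ∀ z, B z = j → A z = j ∧ z ≠ g' ∨ z = g := by
    intro z hz
    rw [h.eq_swap, Function.comp_apply] at hz
    by_cases h₁ : z = g; · exact .inr h₁
    by_cases h₂ : z = g'
    · rw [h₂, Equiv.swap_apply_right, h.left] at hz; exact absurd hz hne
    · rw [Equiv.swap_apply_of_ne_of_ne h₁ h₂] at hz; exact .inl ⟨hz, h₂⟩
  refine ⟨C ∘ e, ?_, fun l => ?_, ?_⟩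
  · rcases hC with hC | ⟨c, hc, hC⟩
    · exact absurd hy' (by simpa using (Finset.ext_iff.1 hC y).not)
    · have hc : C c = j := by simpa using hc
      refine .inr ⟨e c, by simp [ee, hc], ?_⟩
      have s₁ : util u (bundle (C ∘ e) j \ {e c}) = ∑ z ∈ bundle C j \ {c}, u (e z) := by
        refine Finset.sum_bij (fun z _ => e z) (fun z hz => ?_) (fun a _ b _ h => e.injective h)
          (fun z hz => ⟨e z, ?_, ee z⟩) fun z _ => by rw [ee]
        · simp only [Finset.mem_sdiff, mem_bundle, Function.comp_apply, Finset.mem_singleton] at *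
          exact ⟨hz.1, fun h => hz.2 (by rw [← h, ee])⟩
        · simp only [Finset.mem_sdiff, mem_bundle, Function.comp_apply, Finset.mem_singleton] at *
          exact ⟨by rw [ee]; exact hz.1, fun h => hz.2 (e.injective h)⟩
      have s₂ : util u (bundle (C ∘ e) i) = ∑ z ∈ bundle C i, u (e z) := by
        refine Finset.sum_bij (fun z _ => e z) (fun z hz => ?_) (fun a _ b _ h => e.injective h)
          (fun z hz => ⟨e z, ?_, ee z⟩) fun z _ => by rw [ee]
        · simpa using hz
        · simpa [ee] using hz
      change util u _ ≤ util u _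
      rw [s₁, s₂]
      refine (Finset.sum_le_sum fun z hz => dec z ?_).trans (hC.trans (Finset.sum_le_sum fun z hz =>
        inc z ?_))
      · simp only [Finset.mem_sdiff, mem_bundle] at hz; exact hz.1
      · simpa using hz
  · rw [card_bundle_comp, hcard, h.eq_swap, card_bundle_comp]
  · have hsub : (bundle B j \ bundle (C ∘ e) j).image e ⊆ (bundle A j \ bundle C j).erase x := by
      intro z hz
      obtain ⟨w, hw, rfl⟩ := Finset.mem_image.1 hz
      simp only [Finset.mem_sdiff, mem_bundle, Function.comp_apply] at hw
      simp only [Finset.mem_erase, Finset.mem_sdiff, mem_bundle]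
      rcases hB w hw.1 with ⟨h₁, h₂⟩ | rfl
      · exact ⟨fun h => h₂ (e.injective (h.trans e₁.symm)), by rw [Ae]; exact h₁, hw.2⟩
      · exact absurd (by rw [e₃]; exact hy') hw.2
    have h₁ := Finset.card_le_card hsub
    rw [Finset.card_image_of_injective _ e.injective] at h₁
    have h₂ : x ∈ bundle A j \ bundle C j := by simp [hx, hx', hne]
    have h₃ := Finset.card_erase_add_one h₂
    simp only [moved]
    omega

end GreedyStep

end Greedy
end FairDivision
end

/-! ### Runs of the greedy algorithm -/

noncomputable section
namespace FairDivision

section Greedy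

variable {M : Type*} [Fintype M] [DecidableEq M] {u : M → ℝ≥0}

theorem ef1_of_towards {A : Allocation Bool M} {i j : Bool} (hij : i ≠ j)
    (h : EF1Towards (fun _ => u) A i j) (h' : EF1Towards (fun _ => u) A j i) :
    EF1 (fun _ => u) A := by
  intro a b hab
  obtain ⟨rfl, rfl⟩ | ⟨rfl, rfl⟩ : (a = i ∧ b = j) ∨ (a = j ∧ b = i) := by
    cases a <;> cases b <;> cases i <;> cases j <;> simp_all
  · exact h
  · exact h'

theorem GreedyRun.reachedIn {T : ℕ} {A B : Allocation Bool M} (h : GreedyRun u T A B) :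
    ReachedIn T A B := by
  obtain ⟨s, h₀, hT, h⟩ := h
  refine ⟨s, h₀, hT, fun t ht => ?_⟩
  obtain ⟨i, j, g, g', h, -⟩ := (h t ht).2
  exact ⟨i, j, g, g', h⟩

/-- The distance to a suitable target drops with every exchange. The first conjunct keeps the pair
`i`, `j` fixed along the run; without it, the targets of successive steps could not be chained. -/
theorem GreedyRun.exists_closer {T : ℕ} {A B : Allocation Bool M} (h : GreedyRun u T A B)
    {i j : Bool} (hij : i ≠ j) (hA : ¬ EF1Towards (fun _ => u) A i j) {C : Allocation Bool M}
    (hC : EF1Towards (fun _ => u) C i j) (hcard : ∀ l, (bundle C l).card = (bundle A l).card) :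
    (¬ EF1 (fun _ => u) B → ¬ EF1Towards (fun _ => u) B i j) ∧
    ∃ C' : Allocation Bool M, EF1Towards (fun _ => u) C' i j ∧
      (∀ l, (bundle C' l).card = (bundle B l).card) ∧ moved j B C' + T ≤ moved j A C := by
  obtain ⟨s, rfl, rfl, h⟩ := h
  induction T with
  | zero => exact ⟨fun _ => hA, C, hC, hcard, le_rfl⟩
  | succ T ih =>
    obtain ⟨h₁, C', hC', hcard', hle⟩ := ih fun t ht => h t (by omega)
    obtain ⟨h₂, h₃⟩ := h T (by omega)
    have h₄ := h₁ h₂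
    obtain ⟨g, g', h₅⟩ := h₃.exists_step hij (util_lt_of_not_ef1Towards h₄)
    obtain ⟨C'', hC'', hcard'', hle'⟩ := h₅.exists_closer h₄ hC' hcard'
    exact ⟨fun h₆ h₇ => h₆ (ef1_of_towards hij h₇ (h₅.ef1Towards h₄)), C'', hC'', hcard'',
      by omega⟩

theorem exists_not_ef1Towards {A : Allocation Bool M} (h : ¬ EF1 (fun _ => u) A) :
    ∃ i j, i ≠ j ∧ ¬ EF1Towards (fun _ => u) A i j := by
  simp only [EF1, not_forall] at h
  obtain ⟨i, j, h, h'⟩ := h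
  exact ⟨i, j, h, h'⟩

theorem optimalExchanges_le {T : ℕ} {A B : Allocation Bool M} (h : ReachedIn T A B)
    (hB : EF1 (fun _ => u) B) : optimalExchanges (fun _ => u) A ≤ T :=
  iInf₂_le_of_le B hB (iInf₂_le T h)

theorem exists_of_optimalExchanges_ne_top {A : Allocation Bool M}
    (h : optimalExchanges (fun _ => u) A ≠ ⊤) :
    ∃ T C, ReachedIn T A C ∧ EF1 (fun _ => u) C := by
  by_contra! h'
  refine h ?_
  simp only [optimalExchanges, exchangeDist, iInf_eq_top]
  exact fun C hC T hT => absurd hC (h' T C hT)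

theorem GreedyRun.exists_le_moved {T : ℕ} {A B C : Allocation Bool M} (h : GreedyRun u T A B)
    (hC : EF1 (fun _ => u) C) (hcard : ∀ l, (bundle C l).card = (bundle A l).card) :
    ∃ j, T ≤ moved j A C := by
  rcases Nat.eq_zero_or_pos T with rfl | hT
  · exact ⟨true, Nat.zero_le _⟩
  have hA : ¬ EF1 (fun _ => u) A := by
    obtain ⟨s, rfl, -, h⟩ := h
    exact (h 0 hT).1
  obtain ⟨i, j, hij, hA⟩ := exists_not_ef1Towards hA
  obtain ⟨-, C', -, -, hle⟩ := h.exists_closer hij hA (hC i j hij) hcard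
  exact ⟨j, by omega⟩

theorem GreedyRun.le_optimalExchanges {T : ℕ} {A B : Allocation Bool M} (h : GreedyRun u T A B) :
    (T : ℕ∞) ≤ optimalExchanges (fun _ => u) A := by
  refine le_iInf₂ fun C hC => le_iInf₂ fun T' hT' => ?_
  obtain ⟨j, hj⟩ := h.exists_le_moved hC hT'.card_eq
  exact_mod_cast hj.trans (hT'.moved_le j)

/-- A run is bounded by the movement towards one reachable EF1 allocation, and that movement counts
distinct goods. This justifies simulating only as many rounds as there are goods. -/
theorem GreedyRun.le_card {T : ℕ} {A B : Allocation Bool M} (h : GreedyRun u T A B)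
    (hA : optimalExchanges (fun _ => u) A ≠ ⊤) : T ≤ Fintype.card M := by
  obtain ⟨T', C, hT', hC⟩ := exists_of_optimalExchanges_ne_top hA
  obtain ⟨j, hj⟩ := h.exists_le_moved hC hT'.card_eq
  exact hj.trans (Finset.card_le_univ _)

theorem GreedyRun.eq_optimalExchanges {T : ℕ} {A B : Allocation Bool M} (h : GreedyRun u T A B)
    (hB : EF1 (fun _ => u) B) : (T : ℕ∞) = optimalExchanges (fun _ => u) A :=
  h.le_optimalExchanges.antisymm (optimalExchanges_le h.reachedIn hB)

/-- Bundle sizes are invariant, so an empty bundle would be empty in a reachable EF1 allocation too.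
The other agent would own everything in both, so the two allocations would be equal. -/
theorem GreedyRun.bundle_nonempty {T : ℕ} {A B : Allocation Bool M} (h : GreedyRun u T A B)
    (hA : optimalExchanges (fun _ => u) A ≠ ⊤) (hB : ¬ EF1 (fun _ => u) B) (l : Bool) :
    (bundle B l).Nonempty := by
  obtain ⟨T', C, hT', hC⟩ := exists_of_optimalExchanges_ne_top hA
  have hcard : ∀ l, (bundle C l).card = (bundle B l).card := fun l => by
    rw [hT'.card_eq, h.reachedIn.card_eq]
  by_contra! hl
  have hl' : bundle C l = ∅ := by rw [← Finset.card_eq_zero, hcard, hl, Finset.card_empty]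
  have : B = C := by
    funext x
    have h₁ := (Finset.ext_iff.1 hl x).not
    have h₂ := (Finset.ext_iff.1 hl' x).not
    simp only [mem_bundle, Finset.notMem_empty, not_false_iff, iff_true] at h₁ h₂
    cases hb : B x <;> cases hc : C x <;> cases l <;> simp_all
  exact hB (this ▸ hC)

theorem exists_greedyExchange {B : Allocation Bool M} (h : ∀ l, (bundle B l).Nonempty) {i j : Bool}
    (hij : util u (bundle B i) < util u (bundle B j)) : ∃ C, GreedyExchange u B C := by
  obtain ⟨g, hg, hg'⟩ := (bundle B i).exists_min_image u (h i)
  obtain ⟨k, hk, hk'⟩ := (bundle B j).exists_max_image u (h j)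
  exact ⟨_, i, j, g, k, exchangeOf_swap (by rintro rfl; exact lt_irrefl _ hij) (by simpa using hg)
    (by simpa using hk), hij, hg', hk'⟩

theorem greedy_optimal {A : Allocation Bool M} (hA : optimalExchanges (fun _ => u) A ≠ ⊤) (T : ℕ)
    (B : Allocation Bool M) (h : GreedyRun u T A B) :
    (T : ℕ∞) ≤ optimalExchanges (fun _ => u) A ∧
      (EF1 (fun _ => u) B → (T : ℕ∞) = optimalExchanges (fun _ => u) A) ∧
      (¬ EF1 (fun _ => u) B → ∃ C : Allocation Bool M, GreedyExchange u B C) := by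
  refine ⟨h.le_optimalExchanges, h.eq_optimalExchanges, fun hB => ?_⟩
  obtain ⟨i, j, -, hij⟩ := exists_not_ef1Towards hB
  exact exists_greedyExchange (h.bundle_nonempty hA hB) (util_lt_of_not_ef1Towards hij)

theorem GreedyRun.succ {T : ℕ} {A B C : Allocation Bool M} (h : GreedyRun u T A B)
    (hB : ¬ EF1 (fun _ => u) B) (hC : GreedyExchange u B C) : GreedyRun u (T + 1) A C := by
  obtain ⟨s, h₀, hT, h⟩ := h
  refine ⟨fun t => if t ≤ T then s t else C, by simpa, by simp, fun t ht => ?_⟩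
  rcases (Nat.lt_succ_iff.1 ht).lt_or_eq with h₁ | rfl
  · simpa [h₁.le, h₁, Nat.succ_le_iff] using h t h₁
  · simpa [hT] using ⟨hB, hC⟩

end Greedy

/-! ### Correctness of the algorithm on lists of fractions -/

/-- The value of a fraction. -/
def fracVal (x : ℕ × ℕ) : ℝ≥0 := x.1 / x.2

theorem fracLe_iff {x y : ℕ × ℕ} (hx : 0 < x.2) (hy : 0 < y.2) :
    fracLe x y = true ↔ fracVal x ≤ fracVal y := by
  rw [fracLe, decide_eq_true_iff, fracVal, fracVal, div_le_div_iff₀ (by exact_mod_cast hx)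
    (by exact_mod_cast hy)]
  exact_mod_cast Iff.rfl

theorem fracSum_spec (l : List (ℕ × ℕ)) (hl : ∀ x ∈ l, 0 < x.2) :
    0 < (fracSum l).2 ∧ fracVal (fracSum l) = (l.map fracVal).sum := by
  induction l using List.reverseRecOn with
  | nil => simp [fracSum, fracVal]
  | append_singleton l x ih =>
    obtain ⟨h₁, h₂⟩ := ih fun y hy => hl y (by simp [hy])
    have hx := hl x (by simp)
    have e : fracSum (l ++ [x]) = fracAdd (fracSum l) x := by simp [fracSum]
    rw [e]
    refine ⟨Nat.mul_pos h₁ hx, ?_⟩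
    rw [List.map_append, List.sum_append, ← h₂]
    have h₁' : ((fracSum l).2 : ℝ≥0) ≠ 0 := by exact_mod_cast h₁.ne'
    have hx' : (x.2 : ℝ≥0) ≠ 0 := by exact_mod_cast hx.ne'
    simp only [fracVal, fracAdd, List.map_cons, List.map_nil, List.sum_cons, List.sum_nil, add_zero]
    push_cast
    field_simp

theorem le_pickMax (x : ℕ × ℕ) (l : List (ℕ × ℕ)) (hl : ∀ y ∈ x :: l, 0 < y.2) :
    ∀ y ∈ x :: l, fracVal y ≤ fracVal (pickMax x l).1 := by
  induction l using List.reverseRecOn with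
  | nil => simp [pickMax]
  | append_singleton l z ih =>
    have ih := ih fun y hy => hl y (by simp at hy ⊢; tauto)
    have hz := hl z (by simp)
    have hp : 0 < (pickMax x l).1.2 := by
      have := (pickMax_perm x l).mem_iff.1 List.mem_cons_self
      exact hl _ (by simp at this ⊢; tauto)
    have e : (pickMax x (l ++ [z])).1 =
        bif fracLe (pickMax x l).1 z then z else (pickMax x l).1 := by
      simp only [pickMax, List.foldl_append, List.foldl_cons, List.foldl_nil]
      cases fracLe _ z <;> rfl
    rw [e]
    intro y hy
    have hy : y ∈ x :: l ∨ y = z := by simp at hy ⊢; tauto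
    have h := fracLe_iff hp hz
    cases hb : fracLe (pickMax x l).1 z
    · rw [hb] at h
      have h : fracVal z < fracVal (pickMax x l).1 := by simpa using h
      rcases hy with hy | rfl
      · exact ih y hy
      · exact h.le
    · rw [hb] at h
      rcases hy with hy | rfl
      · exact (ih y hy).trans (h.1 rfl)
      · exact le_rfl

theorem pickMin_le (x : ℕ × ℕ) (l : List (ℕ × ℕ)) (hl : ∀ y ∈ x :: l, 0 < y.2) :
    ∀ y ∈ x :: l, fracVal (pickMin x l).1 ≤ fracVal y := by
  induction l using List.reverseRecOn with
  | nil => simp [pickMin]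
  | append_singleton l z ih =>
    have ih := ih fun y hy => hl y (by simp at hy ⊢; tauto)
    have hz := hl z (by simp)
    have hp : 0 < (pickMin x l).1.2 := by
      have := (pickMin_perm x l).mem_iff.1 List.mem_cons_self
      exact hl _ (by simp at this ⊢; tauto)
    have e : (pickMin x (l ++ [z])).1 =
        bif fracLe z (pickMin x l).1 then z else (pickMin x l).1 := by
      simp only [pickMin, List.foldl_append, List.foldl_cons, List.foldl_nil]
      cases fracLe z _ <;> rfl
    rw [e]
    intro y hy
    have hy : y ∈ x :: l ∨ y = z := by simp at hy ⊢; tauto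
    have h := fracLe_iff hz hp
    cases hb : fracLe z (pickMin x l).1
    · rw [hb] at h
      have h : fracVal (pickMin x l).1 < fracVal z := by simpa using h
      rcases hy with hy | rfl
      · exact ih y hy
      · exact h.le
    · rw [hb] at h
      rcases hy with hy | rfl
      · exact (h.1 rfl).trans (ih y hy)
      · exact le_rfl

section Lists

variable {M : Type*} [Fintype M] [DecidableEq M] {f : M → ℕ × ℕ}

/-- The list `l` holds the fractions of the goods of agent `b`. -/
def Lists (f : M → ℕ × ℕ) (A : Allocation Bool M) (b : Bool) (l : List (ℕ × ℕ)) : Prop :=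
  (bundle A b).val.map f = l

namespace Lists

variable {A : Allocation Bool M} {b : Bool} {l : List (ℕ × ℕ)}

theorem mem_iff (h : Lists f A b l) (x : ℕ × ℕ) : x ∈ l ↔ ∃ g, A g = b ∧ f g = x := by
  rw [← Multiset.mem_coe, ← h]
  simp

theorem perm (h : Lists f A b l) {l' : List (ℕ × ℕ)} (h' : l'.Perm l) : Lists f A b l' := by
  rw [Lists, h]
  exact (Multiset.coe_eq_coe.2 h').symm

theorem pos (hf : ∀ g, 0 < (f g).2) (h : Lists f A b l) : ∀ x ∈ l, 0 < x.2 := by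
  intro x hx
  obtain ⟨g, -, rfl⟩ := (h.mem_iff x).1 hx
  exact hf g

theorem isEmpty_iff (h : Lists f A b l) : l.isEmpty = true ↔ bundle A b = ∅ := by
  rw [List.isEmpty_iff, ← Multiset.coe_eq_zero, ← h, Multiset.map_eq_zero, Finset.val_eq_zero]

theorem fracVal_sum (hf : ∀ g, 0 < (f g).2) (h : Lists f A b l) :
    fracVal (fracSum l) = util (fun g => fracVal (f g)) (bundle A b) := by
  rw [(fracSum_spec l (h.pos hf)).2, util, Finset.sum, ← Multiset.sum_coe, ← Multiset.map_coe, ← h,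
    Multiset.map_map]
  rfl

/-- The existential over the removed good is settled by a most valuable one, since removing it
leaves the least. -/
theorem ef1Towards_iff (hf : ∀ g, 0 < (f g).2) {i j : Bool} {l l' : List (ℕ × ℕ)}
    (h : Lists f A i l) (h' : Lists f A j l') :
    ef1Towards l l' = true ↔ EF1Towards (fun _ g => fracVal (f g)) A i j := by
  rw [ef1Towards, EF1Towards, Bool.or_eq_true, h'.isEmpty_iff]
  obtain _ | ⟨y, l'⟩ := l'
  · simp [h'.isEmpty_iff.1 rfl]
  have hne : bundle A j ≠ ∅ := fun e => by simpa using h'.isEmpty_iff.2 e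
  simp only [hne, false_or, List.headD_cons, List.tail_cons]
  have hp := pickMax_perm y l'
  have hmax := le_pickMax y l' (h'.pos hf)
  generalize pickMax y l' = p at hp hmax
  have h'' := h'.perm hp
  have pos := h''.pos hf
  obtain ⟨g, hg, hgp⟩ := (h''.mem_iff p.1).1 List.mem_cons_self
  have hrest := fracSum_spec p.2 fun x hx => pos x (by simp [hx])
  have e₁ : fracVal (fracSum p.2) = util (fun g => fracVal (f g)) (bundle A j \ {g}) := by
    have h₁ := util_sdiff_add (u := fun g => fracVal (f g)) (S := bundle A j) (g := g) (by simpa)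
    rw [← h''.fracVal_sum hf, (fracSum_spec _ pos).2, List.map_cons, List.sum_cons, hgp, add_comm]
      at h₁
    rw [hrest.2]
    exact (add_left_cancel h₁).symm
  rw [fracLe_iff hrest.1 (fracSum_spec l (h.pos hf)).1, e₁, h.fracVal_sum hf]
  refine ⟨fun h₁ => ⟨g, by simpa, h₁⟩, fun ⟨k, hk, h₁⟩ => le_trans ?_ h₁⟩
  have h₂ := util_sdiff_add (u := fun g => fracVal (f g)) (S := bundle A j) (g := g) (by simpa)
  have h₃ := util_sdiff_add (u := fun g => fracVal (f g)) hk
  have h₄ : fracVal (f k) ≤ fracVal (f g) := by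
    rw [hgp]
    exact hmax _ ((h'.mem_iff _).2 ⟨k, by simpa using hk, rfl⟩)
  rw [← h₃] at h₂
  have h₅ := h₂.le.trans (add_le_add_right h₄ _)
  exact le_of_add_le_add_right h₅

theorem ef1_iff (hf : ∀ g, 0 < (f g).2) {p : List (ℕ × ℕ) × List (ℕ × ℕ)}
    (h : Lists f A false p.1) (h' : Lists f A true p.2) :
    ef1 p = true ↔ EF1 (fun _ g => fracVal (f g)) A := by
  rw [ef1, Bool.and_eq_true, ef1Towards_iff hf h h', ef1Towards_iff hf h' h]
  exact ⟨fun h => ef1_of_towards (by simp) h.1 h.2, fun h => ⟨h _ _ (by simp), h _ _ (by simp)⟩⟩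

theorem swapExtremes_spec (hf : ∀ g, 0 < (f g).2) {i j : Bool} {l l' : List (ℕ × ℕ)} (hij : i ≠ j)
    (h : Lists f A i l) (h' : Lists f A j l') (hi : (bundle A i).Nonempty)
    (hj : (bundle A j).Nonempty)
    (hlt : util (fun g => fracVal (f g)) (bundle A i) < util (fun g => fracVal (f g)) (bundle A j)) :
    ∃ B, GreedyExchange (fun g => fracVal (f g)) A B ∧ Lists f B i (swapExtremes l l').1 ∧
      Lists f B j (swapExtremes l l').2 := by
  obtain _ | ⟨x, l⟩ := l
  · exact absurd (h.isEmpty_iff.1 rfl) hi.ne_empty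
  obtain _ | ⟨y, l'⟩ := l'
  · exact absurd (h'.isEmpty_iff.1 rfl) hj.ne_empty
  have hp := pickMin_perm x l
  have hmin := pickMin_le x l (h.pos hf)
  have hq := pickMax_perm y l'
  have hmax := le_pickMax y l' (h'.pos hf)
  simp only [swapExtremes, List.isEmpty_cons, Bool.or_self, cond_false, List.headD_cons,
    List.tail_cons]
  generalize pickMin x l = p at *
  generalize pickMax y l' = q at *
  have hl := h.perm hp
  have hl' := h'.perm hq
  obtain ⟨g, hg, hgp⟩ := (hl.mem_iff p.1).1 List.mem_cons_self
  obtain ⟨g', hg', hgq⟩ := (hl'.mem_iff q.1).1 List.mem_cons_self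
  have hex := exchangeOf_swap hij hg hg'
  refine ⟨_, ⟨i, j, g, g', hex, hlt, fun k hk => ?_, fun k hk => ?_⟩, ?_, ?_⟩
  · beta_reduce
    rw [hgp]
    exact hmin _ ((h.mem_iff _).2 ⟨k, by simpa using hk, rfl⟩)
  · beta_reduce
    rw [hgq]
    exact hmax _ ((h'.mem_iff _).2 ⟨k, by simpa using hk, rfl⟩)
  · have hne : g' ∉ bundle A i := by simpa [hg'] using hij.symm
    have hgi : g ∈ insert g' (bundle A i) := by simp [hg]
    have e₁ := hex.2.2.2.1
    rw [Finset.union_comm, ← Finset.insert_eq, Finset.sdiff_singleton_eq_erase] at e₁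
    -- The value of `g` is put back on both sides and cancelled, which avoids subtraction of
    -- multisets.
    have e₂ := congrArg (Multiset.map f) (Multiset.cons_erase (Finset.mem_def.1 hgi))
    rw [← Finset.erase_val, ← e₁, Finset.insert_val_of_notMem hne, Multiset.map_cons,
      Multiset.map_cons, hl, hgp, hgq, ← Multiset.cons_coe, Multiset.cons_swap] at e₂
    exact (Multiset.cons_inj_right _).1 e₂
  · have hne : g ∉ bundle A j := by simpa [hg] using hij
    have hgj : g' ∈ insert g (bundle A j) := by simp [hg']
    have e₁ := hex.2.2.2.2.1
    rw [Finset.union_comm, ← Finset.insert_eq, Finset.sdiff_singleton_eq_erase] at e₁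
    have e₂ := congrArg (Multiset.map f) (Multiset.cons_erase (Finset.mem_def.1 hgj))
    rw [← Finset.erase_val, ← e₁, Finset.insert_val_of_notMem hne, Multiset.map_cons,
      Multiset.map_cons, hl', hgp, hgq, ← Multiset.cons_coe, Multiset.cons_swap] at e₂
    exact (Multiset.cons_inj_right _).1 e₂

theorem greedySwap_spec (hf : ∀ g, 0 < (f g).2) {p : List (ℕ × ℕ) × List (ℕ × ℕ)}
    (h : Lists f A false p.1) (h' : Lists f A true p.2) (hne : ∀ b, (bundle A b).Nonempty)
    (hA : ¬ EF1 (fun _ g => fracVal (f g)) A) :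
    ∃ B, GreedyExchange (fun g => fracVal (f g)) A B ∧ Lists f B false (greedySwap p).1 ∧
      Lists f B true (greedySwap p).2 := by
  have hle : fracLe (fracSum p.1) (fracSum p.2) = true ↔ _ :=
    fracLe_iff (fracSum_spec _ (h.pos hf)).1 (fracSum_spec _ (h'.pos hf)).1
  rw [h.fracVal_sum hf, h'.fracVal_sum hf] at hle
  obtain ⟨i, j, hij, hij'⟩ := exists_not_ef1Towards hA
  have hlt := util_lt_of_not_ef1Towards hij'
  rw [greedySwap]
  obtain ⟨rfl, rfl⟩ | ⟨rfl, rfl⟩ : (i = false ∧ j = true) ∨ (i = true ∧ j = false) := by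
    cases i <;> cases j <;> simp_all
  · rw [hle.2 hlt.le]
    exact swapExtremes_spec hf hij h h' (hne _) (hne _) hlt
  · have : fracLe (fracSum p.1) (fracSum p.2) = false := by
      rw [← Bool.not_eq_true, hle]
      exact hlt.not_ge
    rw [this]
    obtain ⟨B, h₁, h₂, h₃⟩ := swapExtremes_spec hf hij h' h (hne _) (hne _) hlt
    exact ⟨B, h₁, h₃, h₂⟩

theorem greedySwap_of_isEmpty {p : List (ℕ × ℕ) × List (ℕ × ℕ)}
    (h : p.1.isEmpty = true ∨ p.2.isEmpty = true) : greedySwap p = p := by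
  have h₁ : (p.1.isEmpty || p.2.isEmpty) = true := by simpa using h
  have h₂ : (p.2.isEmpty || p.1.isEmpty) = true := by rwa [Bool.or_comm]
  rw [greedySwap, swapExtremes, swapExtremes, h₁, h₂]
  cases fracLe (fracSum p.1) (fracSum p.2) <;> rfl

/-- Reachability of the simulated allocation is unconditional, so that finding an EF1 allocation
proves the optimum finite. Only with a finite optimum is the simulation a genuine greedy run;
otherwise it may get stuck at an empty bundle while the counter goes on. -/
theorem foldl_greedyRound_spec (hf : ∀ g, 0 < (f g).2) {l l' : List (ℕ × ℕ)}
    (h : Lists f A false l) (h' : Lists f A true l') {α : Type*} (w : List α) :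
    ∃ B, (∃ T, ReachedIn T A B) ∧
      Lists f B false (w.foldl (fun s _ => greedyRound s) (0, l, l')).2.1 ∧
      Lists f B true (w.foldl (fun s _ => greedyRound s) (0, l, l')).2.2 ∧
      (optimalExchanges (fun _ g => fracVal (f g)) A ≠ ⊤ →
        GreedyRun (fun g => fracVal (f g)) (w.foldl (fun s _ => greedyRound s) (0, l, l')).1 A B ∧
        (EF1 (fun _ g => fracVal (f g)) B ∨
          (w.foldl (fun s _ => greedyRound s) (0, l, l')).1 = w.length)) := by
  induction w using List.reverseRecOn with
  | nil =>
    exact ⟨A, ⟨0, fun _ => A, rfl, rfl, by simp⟩, h, h', fun _ =>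
      ⟨⟨fun _ => A, rfl, rfl, by simp⟩, .inr rfl⟩⟩
  | append_singleton w a ih =>
    rw [List.foldl_append, List.foldl_cons, List.foldl_nil]
    generalize w.foldl (fun s _ => greedyRound s) (0, l, l') = s at ih
    obtain ⟨B, ⟨T, hT⟩, h₁, h₂, h₃⟩ := ih
    have hef := ef1_iff hf h₁ h₂
    rw [greedyRound]
    by_cases hB : EF1 (fun _ g => fracVal (f g)) B
    · rw [hef.2 hB]
      exact ⟨B, ⟨T, hT⟩, h₁, h₂, fun h₄ => ⟨(h₃ h₄).1, .inl hB⟩⟩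
    · have hb : ef1 s.2 = false := by rw [← Bool.not_eq_true, hef]; exact hB
      rw [hb]
      by_cases hne : ∀ b, (bundle B b).Nonempty
      · obtain ⟨C, hC, h₄, h₅⟩ := greedySwap_spec hf h₁ h₂ hne hB
        refine ⟨C, ⟨T + 1, ?_⟩, h₄, h₅, fun h₆ => ⟨(h₃ h₆).1.succ hB hC, .inr ?_⟩⟩
        · obtain ⟨t, e₀, eT, ht⟩ := hT
          obtain ⟨i, j, g, g', hC, -⟩ := hC
          refine ⟨fun n => if n ≤ T then t n else C, by simpa, by simp, fun n hn => ?_⟩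
          rcases (Nat.lt_succ_iff.1 hn).lt_or_eq with h₁ | rfl
          · simpa [h₁.le, h₁, Nat.succ_le_iff] using ht n h₁
          · simpa [eT] using ⟨i, j, g, g', hC⟩
        · simpa using (h₃ h₆).2.resolve_left hB
      · have he : s.2.1.isEmpty = true ∨ s.2.2.isEmpty = true := by
          rw [h₁.isEmpty_iff, h₂.isEmpty_iff, ← Finset.not_nonempty_iff_eq_empty,
            ← Finset.not_nonempty_iff_eq_empty]
          by_contra! h
          exact hne (Bool.forall_bool.2 h)
        rw [greedySwap_of_isEmpty he]
        exact ⟨B, ⟨T, hT⟩, h₁, h₂, fun h₆ => absurd ((h₃ h₆).1.bundle_nonempty h₆ hB) hne⟩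

/-- The number of rounds is the number of goods. By then the simulation has reached an EF1
allocation exactly when the optimum is finite, and its counter is then the optimum. -/
theorem greedyAnswer_iff (hf : ∀ g, 0 < (f g).2) {l l' : List (ℕ × ℕ)}
    (h : Lists f A false l) (h' : Lists f A true l') (k : ℕ) :
    greedyAnswer k l l' = true ↔ optimalExchanges (fun _ g => fracVal (f g)) A ≤ k := by
  obtain ⟨B, ⟨T, hT⟩, h₁, h₂, h₃⟩ := foldl_greedyRound_spec hf h h' (l ++ l')
  have hef := ef1_iff hf h₁ h₂
  rw [greedyAnswer, Bool.and_eq_true, hef, decide_eq_true_iff]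
  have hlen : (l ++ l').length = Fintype.card M := by
    have e₁ := congrArg Multiset.card h
    have e₂ := congrArg Multiset.card h'
    simp only [Multiset.card_map, Finset.card_val, Multiset.coe_card] at e₁ e₂
    rw [List.length_append, ← e₁, ← e₂, ← Finset.card_univ, bundle, bundle]
    have : (Finset.univ.filter fun g => A g = true) = Finset.univ.filter fun g => ¬ A g = false := by
      ext; simp
    rw [this]
    exact Finset.card_filter_add_card_filter_not (s := Finset.univ) fun g => A g = false
  rw [hlen] at h₃
  generalize (l ++ l').foldl (fun s _ => greedyRound s) (0, l, l') = s at *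
  constructor
  · rintro ⟨hB, hk⟩
    have htop : optimalExchanges (fun _ g => fracVal (f g)) A ≠ ⊤ :=
      ((optimalExchanges_le hT hB).trans_lt (ENat.natCast_lt_top T)).ne
    rw [← (h₃ htop).1.eq_optimalExchanges hB]
    exact_mod_cast hk
  · intro hk
    have htop : optimalExchanges (fun _ g => fracVal (f g)) A ≠ ⊤ :=
      (hk.trans_lt (ENat.natCast_lt_top k)).ne
    obtain ⟨h₄, h₅⟩ := h₃ htop
    have hB : EF1 (fun _ g => fracVal (f g)) B := by
      by_contra hB
      -- Failing to be EF1 after all rounds would allow one more exchange, giving a run longer than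
      -- the number of goods.
      obtain ⟨C, hC⟩ := (greedy_optimal htop _ _ h₄).2.2 hB
      have h₆ := (h₄.succ hB hC).le_card htop
      have h₇ := h₅.resolve_left hB
      omega
    refine ⟨hB, ?_⟩
    rw [← h₄.eq_optimalExchanges hB] at hk
    exact_mod_cast hk

end Lists
end Lists
end FairDivision
end

noncomputable section
namespace FairDivision
open Computability (Γ')

/-! ### Correctness of the parser -/

/-- The encoding of a good given by its owner, numerator and denominator. -/
def encTriple (g : Bool × ℕ × ℕ) : List Γ' :=
  Γ'.bra :: Γ'.bit g.1 :: (encNat g.2.1 ++ Γ'.comma :: (encNat g.2.2 ++ [Γ'.ket]))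

/-- The triple that describes a good. -/
def GoodData.triple (g : GoodData) : Bool × ℕ × ℕ := (g.owner, g.num, g.den)

/-- Canonicity makes reading a number invertible: superfluous zeros would be lost by `ofDigits`. -/
theorem encNat_ofDigits {l : List Bool} (h : isCanon l = true) :
    encNat (ofDigits l) = l.reverse.map Γ'.bit := by
  rw [encNat]
  congr 1
  have key (l : List Bool) : ∀ l' : List Bool, (l' = [] ∨ l'.headD false = true) → l = l'.reverse →
      (ofDigits l').bits = l := by
    induction l with
    | nil =>
      intro l' _ h
      have : l' = [] := by simpa using h.symm
      subst this
      rfl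
    | cons b l ih =>
      intro l' hl' h
      have h₁ : l' = l.reverse ++ [b] := by simpa using (congrArg List.reverse h).symm
      have h₂ : ofDigits l' = Nat.bit b (ofDigits l.reverse) := by
        rw [h₁, ofDigits, List.foldl_append]
        rfl
      have h₃ : (l.reverse = [] ∨ l.reverse.headD false = true) := by
        rcases h₅ : l.reverse with _ | ⟨c, t⟩
        · exact .inl rfl
        · rw [h₁, h₅] at hl'
          simpa using hl'
      have h₄ := ih _ h₃ (by simp)
      rw [h₂, Nat.bits_append_bit, h₄]
      intro h₅
      rw [h₅, Nat.zero_bits] at h₄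
      subst h₄
      simpa [h₁] using hl'
  exact key _ l (by simpa [isCanon] using h) rfl

theorem isCanon_reverse_bits (n : ℕ) : isCanon n.bits.reverse = true := by
  induction n using Nat.binaryRec' with
  | zero => simp [isCanon]
  | bit b n hn ih =>
    rw [Nat.bits_append_bit _ _ hn, List.reverse_cons]
    rcases h : n.bits.reverse with _ | ⟨c, t⟩
    · have : n = 0 := by
        rw [← ofDigits_reverse_bits n, h]
        rfl
      simp [isCanon, hn this]
    · simpa [isCanon, h] using ih

/-- The word read by the parser before it enters a state. -/
def unparse (s : ParseState) : List Γ' :=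
  let l := s.2.1.reverse.map Γ'.bit
  let w := encNat s.2.2.1 ++ s.2.2.2.2.2.reverse.flatMap encTriple
  match s.1 with
  | 0 => l
  | 1 => w ++ [Γ'.bra]
  | 2 => w ++ Γ'.bra :: Γ'.bit s.2.2.2.1 :: l
  | 3 => w ++ Γ'.bra :: Γ'.bit s.2.2.2.1 :: (encNat s.2.2.2.2.1 ++ Γ'.comma :: l)
  | _ => w

/-- A state that has not failed determines the word read so far. The side conditions on the goods
ensure that an accepted list is nonempty and has positive denominators, hence is an `Input`. -/
theorem unparse_step (s : ParseState) (x : Γ') (h : (parseStep s x).1 ≠ 5)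
    (hs : (s.1 = 0 → s.2.2.2.2.2 = []) ∧ (s.1 = 4 → s.2.2.2.2.2 ≠ []) ∧
      ∀ g ∈ s.2.2.2.2.2, 0 < g.2.2) :
    unparse (parseStep s x) = unparse s ++ [x] ∧
      ((parseStep s x).1 = 0 → (parseStep s x).2.2.2.2.2 = []) ∧
      ((parseStep s x).1 = 4 → (parseStep s x).2.2.2.2.2 ≠ []) ∧
      ∀ g ∈ (parseStep s x).2.2.2.2.2, 0 < g.2.2 := by
  obtain ⟨p, l, k, o, n, gs⟩ := s
  obtain ⟨h₀, h₄, hg⟩ := hs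
  have sym (x : Γ') : isBit x = true ∧ x = .bit (bitOf x) ∧ symIdx x ≠ 3 ∨
      isBit x = false ∧ (symIdx x = 3 ↔ x = .bra) ∧ (symIdx x = 4 ↔ x = .ket) ∧
        (symIdx x = 5 ↔ x = .comma) := by
    rcases x with _ | (_ | _) | _ | _ | _ <;> simp [isBit, bitOf, symIdx]
  simp only [parseStep] at h ⊢
  by_cases p₀ : p = 0
  · subst p₀
    have h₀ : gs = [] := h₀ rfl
    subst h₀
    rcases sym x with ⟨hb, hx, -⟩ | ⟨hb, hx, -, -⟩
    · simp only [hb, decide_true, cond_true, unparse]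
      simp [← hx]
    · simp only [hb, decide_true, cond_true, cond_false, hx] at h ⊢
      by_cases hc : (decide (x = .bra) && isCanon l) = true
      · simp only [hc, cond_true] at h ⊢
        simp only [Bool.and_eq_true, decide_eq_true_eq] at hc
        simp [unparse, encNat_ofDigits hc.2, hc.1]
      · rw [Bool.not_eq_true] at hc
        simp [hc, parseFail] at h
  by_cases p₁ : p = 1
  · subst p₁
    rcases sym x with ⟨hb, hx, -⟩ | ⟨hb, -, -, -⟩
    · simp only [hb, unparse]
      simp [← hx]
      simpa using hg
    · simp [hb, parseFail] at h
  by_cases p₂ : p = 2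
  · subst p₂
    rcases sym x with ⟨hb, hx, -⟩ | ⟨hb, -, -, hx⟩
    · simp only [hb, unparse]
      simp [← hx]
      simpa using hg
    · simp only [hb, hx] at h ⊢
      by_cases hc : (decide (x = .comma) && isCanon l) = true
      · simp only [hc, cond_true] at h ⊢
        simp only [Bool.and_eq_true, decide_eq_true_eq] at hc
        simp [unparse, encNat_ofDigits hc.2, hc.1]
        simpa using hg
      · rw [Bool.not_eq_true] at hc
        simp [hc, parseFail] at h
  by_cases p₃ : p = 3
  · subst p₃
    rcases sym x with ⟨hb, hx, -⟩ | ⟨hb, -, hx, -⟩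
    · simp only [hb, unparse]
      simp [← hx]
      simpa using hg
    · simp only [hb, hx] at h ⊢
      by_cases hc : (decide (x = .ket) && isCanon l && !l.isEmpty) = true
      · simp only [hc, cond_true] at h ⊢
        simp only [Bool.and_eq_true, decide_eq_true_eq] at hc
        -- A canonical expansion of zero is empty, and the parser rejects an empty denominator.
        have hpos : 0 < ofDigits l := by
          rcases Nat.eq_zero_or_pos (ofDigits l) with h0 | h0
          · have h1 := encNat_ofDigits hc.1.2
            rw [h0] at h1
            have : l = [] := by simpa [encNat] using h1.symm
            simp [this] at hc
          · exact h0
        simp [unparse, encTriple, encNat_ofDigits hc.1.2, hc.1.1, hpos]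
        simpa using hg
      · rw [Bool.not_eq_true] at hc
        simp [hc, parseFail] at h
  by_cases p₄ : p = 4
  · subst p₄
    rcases sym x with ⟨-, -, hx⟩ | ⟨hb, hx, -, -⟩
    · simp [hx, parseFail] at h
    · by_cases hc : x = .bra
      · subst hc
        simp [unparse, symIdx]
        simpa using hg
      · simp [hx, hc, parseFail] at h
  · simp [p₀, p₁, p₂, p₃, p₄, parseFail] at h

theorem parse_ne_five_of_concat (w : List Γ') (x : Γ') (h : (parse (w ++ [x])).1 ≠ 5) :
    (parse w).1 ≠ 5 := by
  intro h'
  refine h ?_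
  rw [parse, List.foldl_append, List.foldl_cons, List.foldl_nil, ← parse]
  simp [parseStep, h', parseFail]

theorem unparse_parse (w : List Γ') (h : (parse w).1 ≠ 5) : unparse (parse w) = w ∧
    ((parse w).1 = 0 → (parse w).2.2.2.2.2 = []) ∧
      ((parse w).1 = 4 → (parse w).2.2.2.2.2 ≠ []) ∧
      ∀ g ∈ (parse w).2.2.2.2.2, 0 < g.2.2 := by
  induction w using List.reverseRecOn with
  | nil => simp [parse, parseInit, unparse]
  | append_singleton w x ih =>
    obtain ⟨h₁, h₂⟩ := ih (parse_ne_five_of_concat w x h)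
    have e : parse (w ++ [x]) = parseStep (parse w) x := by
      rw [parse, List.foldl_append]
      rfl
    rw [e] at h ⊢
    obtain ⟨h₃, h₄⟩ := unparse_step _ x h h₂
    exact ⟨by rw [h₃, h₁], h₄⟩

theorem parse_sound (w : List Γ') (h : (parse w).1 = 4) : ∃ I : Input, encInput I = w := by
  obtain ⟨h₁, -, h₂, h₃⟩ := unparse_parse w (by simp [h])
  have h₂ := h₂ h
  generalize parse w = s at *
  obtain ⟨p, l, k, o, n, gs⟩ := s
  obtain rfl : p = 4 := h
  have : ∃ L : List GoodData, L.map GoodData.triple = gs.reverse := by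
    refine ⟨gs.reverse.attach.map fun g =>
      ⟨g.1.1, g.1.2.1, ⟨g.1.2.2, h₃ g.1 (by simpa using g.2)⟩⟩, ?_⟩
    rw [List.map_map]
    exact List.attach_map_subtype_val gs.reverse
  obtain ⟨L, hL⟩ := this
  refine ⟨⟨L, ?_, k⟩, ?_⟩
  · rintro rfl
    exact h₂ (by simpa using hL.symm)
  · rw [← h₁]
    simp only [unparse, encInput, ← hL, List.flatMap_map]
    rfl

theorem foldl_parse_bits (p : ℕ) (hp : p = 0 ∨ p = 2 ∨ p = 3) (bs l : List Bool) (r) :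
    (bs.map Γ'.bit).foldl parseStep (p, l, r) = (p, bs.reverse ++ l, r) := by
  have sym (b : Bool) : isBit (.bit b) = true ∧ bitOf (.bit b) = b := by
    cases b <;> simp [isBit, bitOf, symIdx]
  induction bs generalizing l with
  | nil => rfl
  | cons b bs ih =>
    rw [List.map_cons, List.foldl_cons]
    have : parseStep (p, l, r) (.bit b) = (p, b :: l, r) := by
      rcases hp with rfl | rfl | rfl <;> simp [parseStep, sym]
    rw [this, ih]
    simp

/-- The opening bracket is left out because it is consumed in different phases: it ends `k` for the
first good and follows a completed good otherwise. -/
theorem foldl_parse_good (p k gs) (g : GoodData) (n : ℕ) (o : Bool) :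
    (encGood g).tail.foldl parseStep (1, p, k, o, n, gs)
      = (4, [], k, false, 0, g.triple :: gs) := by
  have sym (b : Bool) : isBit (.bit b) = true ∧ bitOf (.bit b) = b := by
    cases b <;> simp [isBit, bitOf, symIdx]
  have hd : (g.den : ℕ).bits.isEmpty = false := by
    rw [← Bool.not_eq_true, List.isEmpty_iff]
    intro h
    have := Nat.size_eq_bits_len (g.den : ℕ)
    rw [h, List.length_nil, eq_comm, Nat.size_eq_zero] at this
    exact g.den.ne_zero this
  rw [encGood, List.tail_cons, List.foldl_cons]
  have h₁ : parseStep (1, p, k, o, n, gs) (.bit g.owner) = (2, [], k, g.owner, 0, gs) := by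
    simp [parseStep, sym]
  rw [h₁, List.foldl_append, encNat, foldl_parse_bits _ (by simp), List.foldl_cons, List.append_nil]
  have h₂ : parseStep (2, g.num.bits.reverse, k, g.owner, 0, gs) .comma
      = (3, [], k, g.owner, g.num, gs) := by
    simp [parseStep, isBit, symIdx, isCanon_reverse_bits, ofDigits_reverse_bits]
  rw [h₂, List.foldl_append, encNat, foldl_parse_bits _ (by simp), List.foldl_cons,
    List.append_nil, List.foldl_nil]
  simp [parseStep, isBit, symIdx, isCanon_reverse_bits, ofDigits_reverse_bits, hd, GoodData.triple]

theorem parse_complete (I : Input) : parse (encInput I) =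
    (4, [], I.k, false, 0, (I.goods.map GoodData.triple).reverse) := by
  obtain ⟨L, hL, k⟩ := I
  have key (L : List GoodData) (gs) : (L.flatMap encGood).foldl parseStep (4, [], k, false, 0, gs)
      = (4, [], k, false, 0, (L.map GoodData.triple).reverse ++ gs) := by
    induction L generalizing gs with
    | nil => rfl
    | cons g L ih =>
      have h₁ : parseStep (4, [], k, false, 0, gs) .bra = (1, [], k, false, 0, gs) := by
        simp [parseStep, symIdx]
      have h₂ : encGood g = .bra :: (encGood g).tail := rfl
      rw [List.flatMap_cons, List.foldl_append, h₂, List.foldl_cons, h₁, foldl_parse_good, ih]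
      simp
  obtain _ | ⟨g, L⟩ := L
  · exact absurd rfl hL
  have h₁ : parseStep (0, k.bits.reverse, 0, false, 0, []) .bra = (1, [], k, false, 0, []) := by
    simp [parseStep, symIdx, isBit, isCanon_reverse_bits, ofDigits_reverse_bits]
  have h₂ : encGood g = .bra :: (encGood g).tail := rfl
  rw [parse, encInput, List.foldl_append, encNat, parseInit, foldl_parse_bits _ (by simp),
    List.flatMap_cons, List.foldl_append, List.append_nil, h₂, List.foldl_cons, h₁,
    foldl_parse_good, key]
  simp

theorem goodsOf_perm (b : Bool) (l : List (Bool × ℕ × ℕ)) :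
    (goodsOf b l).Perm ((l.filter fun g => g.1 == b).map Prod.snd) := by
  have key (t : List (ℕ × ℕ)) : (l.foldl (fun s g => bif g.1 == b then g.2 :: s else s) t).Perm
      ((l.filter fun g => g.1 == b).map Prod.snd ++ t) := by
    induction l generalizing t with
    | nil => rfl
    | cons g l ih =>
      rw [List.foldl_cons]
      refine (ih _).trans ?_
      rw [List.filter_cons]
      cases g.1 == b
      · rfl
      · exact List.perm_middle
  simpa [goodsOf] using key []

/-- The utility of a good as a fraction. -/
def Input.frac (I : Input) (g : I.Goods) : ℕ × ℕ := ((I.goods.get g).num, (I.goods.get g).den)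

theorem lists_goodsOf (I : Input) (b : Bool) :
    Lists I.frac I.initial b (goodsOf b (I.goods.map GoodData.triple).reverse) := by
  rw [Lists, Multiset.coe_eq_coe.2 (goodsOf_perm _ _), List.filter_reverse, List.map_reverse,
    Multiset.coe_reverse]
  have e : I.goods.map GoodData.triple
      = (List.finRange I.goods.length).map fun g => (I.goods.get g).triple := by
    conv_lhs => rw [← List.map_get_finRange I.goods, List.map_map]
    rfl
  rw [e, List.filter_map, List.map_map, bundle, Finset.filter_val]
  change Multiset.map _ (Multiset.filter _ (↑(List.finRange I.goods.length) : Multiset I.Goods)) = _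
  rw [Multiset.filter_coe, Multiset.map_coe]
  congr 2

theorem decideWord_iff (w : List Γ') : decideWord w = true ↔ w ∈ OptimalExchangesTwoIdentical := by
  have key (I : Input) : decideWord (encInput I) = true ↔ I.IsYes := by
    rw [decideWord, parse_complete]
    simp only [decide_true, Bool.true_and]
    rw [Lists.greedyAnswer_iff (fun g => (I.goods.get g).den.pos) (lists_goodsOf I false)
      (lists_goodsOf I true)]
    rfl
  constructor
  · intro h
    have h₁ : (parse w).1 = 4 := by
      rw [decideWord, Bool.and_eq_true, decide_eq_true_iff] at h
      exact h.1
    obtain ⟨I, rfl⟩ := parse_sound w h₁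
    exact ⟨I, rfl, (key I).1 h⟩
  · rintro ⟨I, rfl, hI⟩
    exact (key I).2 hI

end FairDivision
end

theorem mainTheorem10 :
    FairDivision.InP FairDivision.OptimalExchangesTwoIdentical ∧
    ∀ (M : Type*) [Fintype M] [DecidableEq M] (u : M → ℝ≥0)
      (A : FairDivision.Allocation Bool M),
      FairDivision.optimalExchanges (fun _ => u) A ≠ ⊤ →
      ∀ (T : ℕ) (B : FairDivision.Allocation Bool M), FairDivision.GreedyRun u T A B →
        (T : ℕ∞) ≤ FairDivision.optimalExchanges (fun _ => u) A ∧
        (FairDivision.EF1 (fun _ => u) B →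
          (T : ℕ∞) = FairDivision.optimalExchanges (fun _ => u) A) ∧
        (¬ FairDivision.EF1 (fun _ => u) B →
          ∃ C : FairDivision.Allocation Bool M, FairDivision.GreedyExchange u B C) :=
  ⟨FairDivision.inP_of_polyTime FairDivision.PolyTime.decideWord FairDivision.decideWord_iff,
    fun _ _ _ _ _ hA T B h => FairDivision.greedy_optimal hA T B h⟩
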